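/- Let $k$ be an infinite field (for instance an algebraically closed field), $R=k[x_0,x_1,x_2]$ and let $n\ge 2$ be an integer. For a finite subscheme $Z\subset\mathbb{P}^2_k\times\mathbb{P}^2_k$ let $\ell(Z)=\dim_k\Gamma(Z,\mathcal{O}_Z)$ (this is the length of $Z$ if $k$ is algebraically closed). A closed subscheme $X\subset\mathbb{P}^2_k\times\mathbb{P}^2_k$ is said to have multidegree $(d_0,d_1,d_2)$ if, for each $i\in\{0,1,2\}$ and for general linear subspaces $H^i,H^{2-i}\subset\mathbb{P}^2_k$ of codimension $i$ and $2-i$, the scheme $X\cap p_1^{-1}(H^i)\cap p_2^{-1}(H^{2-i})$ is finite with $\ell\big(X\cap p_1^{-1}(H^i)\cap p_2^{-1}(H^{2-i})\big)=d_i$, where $p_1,p_2$ are the two projections. Let $$M=\begin{pmatrix}\lambda_0&p_0\\ \lambda_1&p_1\\ \lambda_2&p_2\end{pmatrix}$$ be a matrix with entries in $R$ such that, for every $j$, $\lambda_j$ is homogeneous of degree $1$ and belongs to $(x_0,x_1)$, and $p_j$ is homogeneous of degree $n-1$ and belongs to $(x_0,x_1)^{n-2}$, and such that $p_j\notin(x_0,x_1)^{n-1}$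 for at least one $j$. Let $\phi_j$ be $(-1)^j$ times the $2$-minor of $M$ obtained by leaving out the row of index $j$ $(j=0,1,2)$, let $I=(\phi_0,\phi_1,\phi_2)\subset R$, and let $\Phi=(\phi_0:\phi_1:\phi_2):\mathbb{P}^2_k\dashrightarrow\mathbb{P}^2_k$. Assume that $I$ has height $2$ and that $\Phi$ is dominant (no nonzero homogeneous polynomial vanishes on the image of $\Phi$). Let $\Gamma\subset\mathbb{P}^2_k\times\mathbb{P}^2_k$ be the graph of $\Phi$, that is the Zariski closure of $\{(x,\Phi(x)) : x\notin V(I)\}$ (with its reduced structure), let $\mathbb{P}(I)=\mathrm{Proj}(\mathrm{Sym}_R(I))\subset\mathbb{P}^2_k\times\mathbb{P}^2_k$ be the naive graph of $\Phi$, embedded through the surjection $R[y_0,y_1,y_2]\to\mathrm{Sym}_R(I)$, $y_j\mapsto\phi_j$, and let the torsion component $\mathbb{T}$ be the scheme-theoretic closure of $\mathbb{P}(I)\setminus\Gamma$ in $\mathbb{P}(I)$. Then: 1. $\mathbb{T}$ has multidegree $(n-2,0,0)$; 2. $\Gamma$ has multidegree $(1,n,1)$; 3. $\Phi$ is birational: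 there are homogeneous polynomials $\psi_0,\psi_1,\psi_2$ of the same degree and nonzero polynomials $h,g$ such that $\psi_j(\phi_0,\phi_1,\phi_2)=h\,x_j$ and $\phi_j(\psi_0,\psi_1,\psi_2)=g\,x_j$ for all $j$. -/

import Mathlib

open MvPolynomial

noncomputable section

namespace PlaneMap

/-- The coordinate ring `k[x₀, x₁, x₂]` of the projective plane. -/
abbrev PlaneRing (k : Type*) [Field k] : Type _ := MvPolynomial (Fin 3) k

/-- The bigraded coordinate ring `k[x₀, x₁, x₂, y₀, y₁, y₂]` of `ℙ² × ℙ²`;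
the left summand indexes the `x`-variables, the right one the `y`-variables. -/
abbrev BiRing (k : Type*) [Field k] : Type _ := MvPolynomial (Fin 3 ⊕ Fin 3) k

variable {k : Type*} [Field k]

/-! ### Zero-dimensional schemes and multidegrees in `ℙ² × ℙ²`

A closed subscheme of `ℙ² × ℙ²` is given by a bihomogeneous ideal of `BiRing k`; two ideals
with the same saturation with respect to `(x₀,x₁,x₂)(y₀,y₁,y₂)` give the same subscheme, and all
the notions below only depend on the subscheme. -/

/-- The linear form `a₀ x₀ + a₁ x₁ + a₂ x₂`. -/
def xForm (a : Fin 3 → k) : BiRing k := ∑ i, C (a i) * X (Sum.inl i)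

/-- The linear form `b₀ y₀ + b₁ y₁ + b₂ y₂`. -/
def yForm (b : Fin 3 → k) : BiRing k := ∑ i, C (b i) * X (Sum.inr i)

/-- The irrelevant ideal `(x₀,x₁,x₂)(y₀,y₁,y₂)` of `ℙ² × ℙ²`. -/
def irrelevant (k : Type*) [Field k] : Ideal (BiRing k) :=
  Ideal.span (Set.range fun i : Fin 3 => X (Sum.inl i)) *
    Ideal.span (Set.range fun i : Fin 3 => X (Sum.inr i))

/-- The subscheme of `ℙ² × ℙ²` defined by the bihomogeneous ideal `J` is empty. -/
def IsEmptyScheme (J : Ideal (BiRing k)) : Prop := ∃ N : ℕ, irrelevant k ^ N ≤ J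

/-- The coordinate ring of the trace, on the affine chart `{u ≠ 0} × {v ≠ 0}` of `ℙ² × ℙ²`, of
the subscheme defined by the bihomogeneous ideal `J`: one puts `u = v = 1` in `BiRing k ⧸ J`. -/
abbrev ChartRing (J : Ideal (BiRing k)) (u v : Fin 3 → k) : Type _ :=
  BiRing k ⧸ (J ⊔ Ideal.span {xForm u - 1, yForm v - 1})

/-- The closed subscheme `Z` of `ℙ² × ℙ²` defined by the bihomogeneous ideal `J` is finite and
`dim_k Γ(Z, 𝒪_Z) = d`. Over an algebraically closed field this dimension is the length of `Z`.
It is computed on an affine chart `{u ≠ 0} × {v ≠ 0}` that contains `Z`. -/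
def HasLength (J : Ideal (BiRing k)) (d : ℕ) : Prop :=
  ∃ u v : Fin 3 → k,
    IsEmptyScheme (J ⊔ Ideal.span {xForm u}) ∧ IsEmptyScheme (J ⊔ Ideal.span {yForm v}) ∧
    Module.Finite k (ChartRing J u v) ∧ Module.finrank k (ChartRing J u v) = d

/-- The subscheme `X` defined by `J` meets `p₁⁻¹(Hⁱ) ∩ p₂⁻¹(Hʲ)` in a scheme of length `d`, for a
general linear subspace `Hⁱ` of codimension `i` of the first plane and a general linear subspace
`Hʲ` of codimension `j` of the second plane. The subspaces are cut out by `i` linear forms in `x`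
and `j` linear forms in `y`; "general" means: for all systems of coefficients in a nonempty
principal open subset `{F ≠ 0}` of the affine space of coefficients. -/
def GeneralSectionLength (J : Ideal (BiRing k)) (i j d : ℕ) : Prop :=
  ∃ F : MvPolynomial ((Fin i × Fin 3) ⊕ (Fin j × Fin 3)) k, F ≠ 0 ∧
    ∀ (a : Fin i → Fin 3 → k) (b : Fin j → Fin 3 → k),
      eval (Sum.elim (fun s => a s.1 s.2) (fun s => b s.1 s.2)) F ≠ 0 →
      HasLength (J ⊔ Ideal.span (Set.range fun s => xForm (a s))
        ⊔ Ideal.span (Set.range fun s => yForm (b s))) d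

/-- The subscheme `X` of `ℙ² × ℙ²` defined by `J` has multidegree `(d 0, d 1, d 2)`: for each `i`,
the scheme `X ∩ p₁⁻¹(Hⁱ) ∩ p₂⁻¹(H²⁻ⁱ)` has length `d i` for general linear subspaces `Hⁱ`, `H²⁻ⁱ` of
codimension `i` and `2 - i`. -/
def HasMultidegree (J : Ideal (BiRing k)) (d : Fin 3 → ℕ) : Prop :=
  ∀ i : Fin 3, GeneralSectionLength J (i : ℕ) (2 - (i : ℕ)) (d i)

/-! ### Rational maps of the plane, their graphs and naive graphs

A rational map `Φ = (φ₀ : φ₁ : φ₂)` is given by homogeneous polynomials of the same degree. -/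

/-- The base ideal `(φ₀, φ₁, φ₂)`. -/
def baseIdeal (φ : Fin 3 → PlaneRing k) : Ideal (PlaneRing k) := Ideal.span (Set.range φ)

/-- The value `(φ₀(x), φ₁(x), φ₂(x))`. -/
def value (φ : Fin 3 → PlaneRing k) (x : Fin 3 → k) : Fin 3 → k := fun j => eval x (φ j)

/-- All homogeneous coordinates of the points `(x, Φ(x))` with `x` outside the base locus. -/
def graphCone (φ : Fin 3 → PlaneRing k) : Set (Fin 3 ⊕ Fin 3 → k) :=
  {z | ∃ x : Fin 3 → k, value φ x ≠ 0 ∧ ∃ c : k, c ≠ 0 ∧ z = Sum.elim x (c • value φ x)}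

/-- The ideal of the graph of `Φ`, the Zariski closure of `{(x, Φ(x)) | x ∉ V(φ₀, φ₁, φ₂)}`. -/
def graphIdeal (φ : Fin 3 → PlaneRing k) : Ideal (BiRing k) :=
  vanishingIdeal k (graphCone φ)

/-- The surjection from `R[y₀, y₁, y₂]`, where `R = k[x₀, x₁, x₂]`, onto the symmetric algebra of
the `R`-module `I = (φ₀, φ₁, φ₂)`, that sends `yⱼ` to the degree one element `φⱼ`. -/
def toSym (φ : Fin 3 → PlaneRing k) :
    BiRing k →+* SymmetricAlgebra (PlaneRing k) (baseIdeal φ) :=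
  eval₂Hom ((algebraMap (PlaneRing k) (SymmetricAlgebra (PlaneRing k) (baseIdeal φ))).comp C)
    (Sum.elim
      (fun i => algebraMap (PlaneRing k) (SymmetricAlgebra (PlaneRing k) (baseIdeal φ)) (X i))
      (fun j => SymmetricAlgebra.ι (PlaneRing k) (baseIdeal φ)
        ⟨φ j, Ideal.subset_span (Set.mem_range_self j)⟩))

/-- The ideal of the naive graph `Proj (Sym I)` in `ℙ² × ℙ²`. -/
def naiveGraphIdeal (φ : Fin 3 → PlaneRing k) : Ideal (BiRing k) := RingHom.ker (toSym φ)

/-- The saturation `J : K^∞`, that is the ideal of the scheme-theoretic closure of the complement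
of `V(K)` in the scheme `V(J)`. -/
def saturation (J K : Ideal (BiRing k)) : Ideal (BiRing k) :=
  ⨆ m : ℕ, J.colon ((K ^ m : Ideal (BiRing k)) : Set (BiRing k))

/-- The ideal of the torsion component: the scheme-theoretic closure of the complement of the
graph in the naive graph. -/
def torsionIdeal (φ : Fin 3 → PlaneRing k) : Ideal (BiRing k) :=
  saturation (naiveGraphIdeal φ) (graphIdeal φ)

/-- `Φ` is dominant: its image is not contained in a curve, i.e. no nonzero homogeneous polynomial
vanishes on it. -/
def IsDominantMap (φ : Fin 3 → PlaneRing k) : Prop :=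
  ∀ (d : ℕ) (F : PlaneRing k), F.IsHomogeneous d →
    (∀ x : Fin 3 → k, value φ x ≠ 0 → eval (value φ x) F = 0) → F = 0

/-- `Φ` is birational: there is a rational map `Ψ = (ψ₀ : ψ₁ : ψ₂)` such that `Ψ ∘ Φ` and `Φ ∘ Ψ`
are defined and equal to the identity as rational maps. -/
def IsBirationalMap (φ : Fin 3 → PlaneRing k) : Prop :=
  ∃ (e : ℕ) (ψ : Fin 3 → PlaneRing k), (∀ j, (ψ j).IsHomogeneous e) ∧
    (∃ h : PlaneRing k, h ≠ 0 ∧ ∀ j, bind₁ φ (ψ j) = h * X j) ∧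
    (∃ g : PlaneRing k, g ≠ 0 ∧ ∀ j, bind₁ ψ (φ j) = g * X j)

/-- The signed `2`-minors of a `3 × 2` matrix; the `j`-th one leaves out the `j`-th row. -/
def minors (M : Matrix (Fin 3) (Fin 2) (PlaneRing k)) : Fin 3 → PlaneRing k :=
  fun j => (-1) ^ (j : ℕ) * (M.submatrix j.succAbove id).det

/-- The ideal `(x₀, x₁)`. -/
def pointIdeal (k : Type*) [Field k] : Ideal (PlaneRing k) := Ideal.span {X 0, X 1}

end PlaneMap

end

/-!
Write `n = m + 2`, and write the rows of the matrix as `aⱼ x₀ + bⱼ x₁` and `x₂ qⱼ + rⱼ` with binary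
forms `qⱼ`, `rⱼ` in `x₀`, `x₁` of degrees `m`, `m + 1`; this is what the multiplicity conditions at
`(0 : 0 : 1)` say. Thus `Φ` is a De Jonquières map: for `y = Φ(x)` both columns are orthogonal to `y`,
so `(x₀ : x₁) = (b · y : - a · y)` by the first column, and the second column, which is of degree one
in `x₂`, then determines `x₂`. This gives the inverse `Ψ = (b · y Q : - a · y Q : - R)`, where `Q` and
`R` are obtained from `∑ qⱼ yⱼ` and `∑ rⱼ yⱼ` by substituting `(b · y, - a · y)` for `(x₀, x₁)`.
Both compositions are multiples of the identity by explicit factors, which do not vanish because `Φ` is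
dominant (`JonquieresData.isBirationalMap_of_dominant`).

The multidegree of the graph `Γ` of any birational map with base ideal of height two whose forms have
degree `n` is `(1, n, 1)` (`graphIdeal_hasMultidegree`). Over a general point of the source or of the
target, `Γ` is a reduced point. Over a general line `ℓ` of the source, which avoids the base locus
(`exists_general_line`), `Γ` is isomorphic to `ℓ`, and a general linear form in `y` pulls back to a form
of degree `n` on `ℓ`.

The torsion component lies over the base locus (`exists_pow_mem_torsionIdeal`), which is finite, so
that it does not meet the preimages of a general point or of a general line of the source. Over a
general point `η` of the target it is determined as follows. By the Hilbert-Burch theorem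
(`syzygy_eq_combination`) the naive graph is defined by the equations `∑ (aⱼ x₀ + bⱼ x₁) yⱼ = 0` and
`∑ (x₂ qⱼ + rⱼ) yⱼ = 0`. The fibre of the first one over `η` is a line through `(0 : 0 : 1)` with the
parameters `x₀`, `x₂`, and on this line the second equation is `x₀ ^ m` times the linear equation of
the point `Ψ(η)` of `Γ`. Saturating by the ideal of `Γ` leaves the scheme `x₀ ^ m = 0`, of length
`m = n - 2` (`JonquieresData.torsionIdeal_generalSectionLength_zero_two`).

Lengths are computed by `hasLength_natDegree`, which identifies a subscheme with the spectrum of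
`k[t] ⧸ (P)` by exhibiting its points with values in `k`-algebras.
-/

namespace PlaneMap

universe u

variable {k : Type u} [Field k]

/-! ### Evaluation of homogeneous polynomials and of forms on `ℙ² × ℙ²` -/

theorem aeval_mul_of_isHomogeneous {σ S : Type*} [CommRing S] [Algebra k S]
    {f : MvPolynomial σ k} {d : ℕ} (hf : f.IsHomogeneous d) (t : S) (x : σ → S) :
    aeval (fun i => t * x i) f = t ^ d * aeval x f := by
  rw [aeval_def, aeval_def, eval₂_eq, eval₂_eq, Finset.mul_sum]
  refine Finset.sum_congr rfl fun m hm => ?_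
  have hd : ∑ i ∈ m.support, m i = d := by
    by_contra h
    exact mem_support_iff.1 hm (hf.coeff_eq_zero (h))
  simp only [mul_pow, Finset.prod_mul_distrib, Finset.prod_pow_eq_pow_sum, hd]
  ring

section Forms

variable {S : Type*} [CommRing S] [Algebra k S]

@[simp]
theorem aeval_xForm (x y : Fin 3 → S) (a : Fin 3 → k) :
    aeval (Sum.elim x y) (xForm a) = ∑ i, algebraMap k S (a i) * x i := by
  simp [xForm]

@[simp]
theorem aeval_yForm (x y : Fin 3 → S) (b : Fin 3 → k) :
    aeval (Sum.elim x y) (yForm b) = ∑ i, algebraMap k S (b i) * y i := by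
  simp [yForm]

@[simp]
theorem aeval_rename_inl (x y : Fin 3 → S) (f : PlaneRing k) :
    aeval (Sum.elim x y) (rename Sum.inl f : BiRing k) = aeval x f := by
  rw [aeval_rename, Sum.elim_comp_inl]

@[simp]
theorem aeval_rename_inr (x y : Fin 3 → S) (f : PlaneRing k) :
    aeval (Sum.elim x y) (rename Sum.inr f : BiRing k) = aeval y f := by
  rw [aeval_rename, Sum.elim_comp_inr]

theorem aeval_algebraMap_comp {σ : Type*} (ξ : σ → k) (f : MvPolynomial σ k) :
    aeval (fun i => algebraMap k S (ξ i)) f = algebraMap k S (eval ξ f) := by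
  rw [show (fun i => algebraMap k S (ξ i)) = algebraMap k S ∘ ξ from rfl,
    aeval_algebraMap_apply, aeval_eq_eval]

/-- A vector that is proportional to `ξ`, on which the linear form `u` takes the value `1`, is the
multiple of `ξ` by the value of `u`. -/
theorem eq_mul_of_parallel {ξ u : Fin 3 → k} (hu : ∑ i, u i * ξ i = 1) {x : Fin 3 → S}
    (hx : ∀ i j, x i * algebraMap k S (ξ j) = x j * algebraMap k S (ξ i)) (i : Fin 3) :
    x i = (∑ j, algebraMap k S (u j) * x j) * algebraMap k S (ξ i) := by
  have h1 : ∑ j, algebraMap k S (u j) * algebraMap k S (ξ j) = 1 := by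
    simpa using congrArg (algebraMap k S) hu
  calc x i = x i * ∑ j, algebraMap k S (u j) * algebraMap k S (ξ j) := by rw [h1, mul_one]
    _ = _ := by
      rw [Finset.mul_sum, Finset.sum_mul]
      refine Finset.sum_congr rfl fun j _ => ?_
      linear_combination algebraMap k S (u j) * hx i j

/-- A vector orthogonal to `a` and `b` is proportional to the cross product of `a` and `b`. -/
theorem parallel_cross {a b : Fin 3 → k} {x : Fin 3 → S}
    (ha : ∑ i, algebraMap k S (a i) * x i = 0) (hb : ∑ i, algebraMap k S (b i) * x i = 0)
    (i j : Fin 3) :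
    x i * algebraMap k S (crossProduct a b j) = x j * algebraMap k S (crossProduct a b i) := by
  simp only [Fin.sum_univ_three] at ha hb
  fin_cases i <;> fin_cases j <;> simp [cross_apply]
  · linear_combination -algebraMap k S (b 2) * ha + algebraMap k S (a 2) * hb
  · linear_combination algebraMap k S (b 1) * ha - algebraMap k S (a 1) * hb
  · linear_combination algebraMap k S (b 2) * ha - algebraMap k S (a 2) * hb
  · linear_combination -algebraMap k S (b 0) * ha + algebraMap k S (a 0) * hb
  · linear_combination -algebraMap k S (b 1) * ha + algebraMap k S (a 1) * hb
  · linear_combination algebraMap k S (b 0) * ha - algebraMap k S (a 0) * hb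

end Forms

theorem exists_dot_eq_one {ξ : Fin 3 → k} (hξ : ξ ≠ 0) : ∃ u : Fin 3 → k, ∑ i, u i * ξ i = 1 := by
  obtain ⟨j, hj⟩ := Function.ne_iff.1 hξ
  exact ⟨Pi.single j (ξ j)⁻¹, by simpa [Pi.single_apply] using inv_mul_cancel₀ hj⟩

theorem exists_cross_eq {v z : Fin 3 → k} (hz : z ≠ 0) (hv : ∑ i, v i * z i = 0) :
    ∃ a : Fin 3 → k, crossProduct a z = v := by
  obtain ⟨u, hu⟩ := exists_dot_eq_one hz
  refine ⟨crossProduct u v, ?_⟩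
  simp only [Fin.sum_univ_three] at hu hv
  ext i
  fin_cases i <;> simp [cross_apply]
  · linear_combination v 0 * hu - u 0 * hv
  · linear_combination v 1 * hu - u 1 * hv
  · linear_combination v 2 * hu - u 2 * hv

theorem exists_ne_zero_dot_eq_zero (v : Fin 3 → k) : ∃ z : Fin 3 → k, z ≠ 0 ∧ ∑ i, v i * z i = 0 := by
  by_cases h : v 0 = 0
  · exact ⟨![1, 0, 0], fun h' => by simpa using congrFun h' 0, by simp [Fin.sum_univ_three, h]⟩
  · exact ⟨![-v 1, v 0, 0], fun h' => h (by simpa using congrFun h' 1), by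
      simp [Fin.sum_univ_three]; ring⟩

/-! ### Criteria for emptiness and for the length of a finite scheme -/

/-- The point with homogeneous coordinates `x` and `y` in the `k`-algebra `S` lies on the
subscheme of `ℙ² × ℙ²` defined by `J`. Nothing is required of `x` and `y`, which may be zero. -/
def VanishesAt {S : Type*} [CommRing S] [Algebra k S] (J : Ideal (BiRing k))
    (x y : Fin 3 → S) : Prop :=
  ∀ F ∈ J, aeval (Sum.elim x y) F = 0

section VanishesAt

variable {S : Type*} [CommRing S] [Algebra k S] {J K : Ideal (BiRing k)} {x y : Fin 3 → S}

theorem vanishesAt_iff_le_ker : VanishesAt J x y ↔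
    J ≤ RingHom.ker (aeval (Sum.elim x y) : BiRing k →ₐ[k] S) := Iff.rfl

theorem vanishesAt_sup : VanishesAt (J ⊔ K) x y ↔ VanishesAt J x y ∧ VanishesAt K x y := by
  simp only [vanishesAt_iff_le_ker, sup_le_iff]

theorem vanishesAt_span {s : Set (BiRing k)} : VanishesAt (Ideal.span s) x y ↔
    ∀ F ∈ s, aeval (Sum.elim x y) F = 0 := by
  rw [vanishesAt_iff_le_ker, Ideal.span_le]
  rfl

theorem vanishesAt_sup_range {ι : Type*} {f : ι → BiRing k} :
    VanishesAt (J ⊔ Ideal.span (Set.range f)) x y ↔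
      VanishesAt J x y ∧ ∀ i, aeval (Sum.elim x y) (f i) = 0 := by
  rw [vanishesAt_sup, vanishesAt_span, Set.forall_mem_range]

end VanishesAt

/-- A subscheme of `ℙ² × ℙ²` without points over any field is empty. -/
theorem isEmptyScheme_of_forall_field {J : Ideal (BiRing k)}
    (h : ∀ (D : Type u) [Field D] [Algebra k D] (x y : Fin 3 → D),
      VanishesAt J x y → x = 0 ∨ y = 0) : IsEmptyScheme J := by
  refine Ideal.exists_pow_le_of_le_radical_of_fg ?_ (IsNoetherian.noetherian _)
  rw [irrelevant, Ideal.span_mul_span', Ideal.span_le]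
  rintro _ ⟨_, ⟨i, rfl⟩, _, ⟨j, rfl⟩, rfl⟩
  rw [SetLike.mem_coe, Ideal.radical_eq_sInf, Ideal.mem_sInf]
  rintro P ⟨hJP, hP⟩
  have key : ∀ F : BiRing k, aeval (Sum.elim
      (fun i => algebraMap (BiRing k ⧸ P) (FractionRing (BiRing k ⧸ P))
        (Ideal.Quotient.mk P (X (Sum.inl i))))
      (fun i => algebraMap (BiRing k ⧸ P) (FractionRing (BiRing k ⧸ P))
        (Ideal.Quotient.mk P (X (Sum.inr i))))) F =
      algebraMap (BiRing k ⧸ P) (FractionRing (BiRing k ⧸ P)) (Ideal.Quotient.mk P F) := by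
    intro F
    have : aeval (Sum.elim
      (fun i => algebraMap (BiRing k ⧸ P) (FractionRing (BiRing k ⧸ P))
        (Ideal.Quotient.mk P (X (Sum.inl i))))
      (fun i => algebraMap (BiRing k ⧸ P) (FractionRing (BiRing k ⧸ P))
        (Ideal.Quotient.mk P (X (Sum.inr i))))) =
        (IsScalarTower.toAlgHom k (BiRing k ⧸ P) (FractionRing (BiRing k ⧸ P))).comp
          (Ideal.Quotient.mkₐ k P) := by
      refine algHom_ext fun s => ?_
      cases s <;> simp
    exact DFunLike.congr_fun this F
  have hinj := IsFractionRing.injective (BiRing k ⧸ P) (FractionRing (BiRing k ⧸ P))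
  have hmem : ∀ F : BiRing k, algebraMap (BiRing k ⧸ P) (FractionRing (BiRing k ⧸ P))
      (Ideal.Quotient.mk P F) = 0 ↔ F ∈ P := fun F => by
    rw [map_eq_zero_iff _ hinj, Ideal.Quotient.eq_zero_iff_mem]
  rcases h (FractionRing (BiRing k ⧸ P)) _ _
    (fun F hF => (key F).trans ((hmem F).2 (hJP hF))) with h0 | h0
  · exact P.mul_mem_right _ ((hmem _).1 (congrFun h0 i))
  · exact P.mul_mem_left _ ((hmem _).1 (congrFun h0 j))

theorem aeval_mk_X (K : Ideal (BiRing k)) (F : BiRing k) :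
    aeval (Sum.elim (fun i => Ideal.Quotient.mk K (X (Sum.inl i)))
      (fun j => Ideal.Quotient.mk K (X (Sum.inr j)))) F = Ideal.Quotient.mk K F := by
  have : aeval (Sum.elim (fun i => Ideal.Quotient.mk K (X (Sum.inl i)))
      (fun j => Ideal.Quotient.mk K (X (Sum.inr j)))) = Ideal.Quotient.mkₐ k K := by
    refine algHom_ext fun s => ?_
    cases s <;> simp
  exact DFunLike.congr_fun this F

theorem vanishesAt_mk_X (K : Ideal (BiRing k)) :
    VanishesAt K (fun i => Ideal.Quotient.mk K (X (Sum.inl i)))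
      (fun j => Ideal.Quotient.mk K (X (Sum.inr j))) := fun F hF => by
  rw [aeval_mk_X, Ideal.Quotient.eq_zero_iff_mem.2 hF]

/-- A subscheme that lies in the affine chart `{u ≠ 0} × {v ≠ 0}` is isomorphic to the spectrum of
`k[t]/(P)`, hence of length `deg P`, if it has a point with coordinates `xs`, `ys` in `k[t]/(P)`
and if every point of the chart that lies on it is obtained from this one by substituting for `t`
the value of some fixed function `T`. -/
theorem hasLength_natDegree {J : Ideal (BiRing k)} {u v : Fin 3 → k} {P : Polynomial k}
    (hP : P ≠ 0) (xs ys : Fin 3 → Polynomial k) (T : BiRing k)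
    (hu : ∀ (D : Type u) [Field D] [Algebra k D] (x y : Fin 3 → D), VanishesAt J x y →
      ∑ i, algebraMap k D (u i) * x i = 0 → x = 0 ∨ y = 0)
    (hv : ∀ (D : Type u) [Field D] [Algebra k D] (x y : Fin 3 → D), VanishesAt J x y →
      ∑ i, algebraMap k D (v i) * y i = 0 → x = 0 ∨ y = 0)
    (hz : VanishesAt J (fun i => AdjoinRoot.mk P (xs i)) fun i => AdjoinRoot.mk P (ys i))
    (hzu : ∑ i, algebraMap k _ (u i) * AdjoinRoot.mk P (xs i) = 1)
    (hzv : ∑ i, algebraMap k _ (v i) * AdjoinRoot.mk P (ys i) = 1)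
    (hT : aeval (Sum.elim (fun i => AdjoinRoot.mk P (xs i)) fun i => AdjoinRoot.mk P (ys i)) T =
      AdjoinRoot.root P)
    (hgen : ∀ (S : Type u) [CommRing S] [Algebra k S] (x y : Fin 3 → S), VanishesAt J x y →
      ∑ i, algebraMap k S (u i) * x i = 1 → ∑ i, algebraMap k S (v i) * y i = 1 →
      Polynomial.aeval (aeval (Sum.elim x y) T) P = 0 ∧
        (∀ i, Polynomial.aeval (aeval (Sum.elim x y) T) (xs i) = x i) ∧
        ∀ i, Polynomial.aeval (aeval (Sum.elim x y) T) (ys i) = y i) :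
    HasLength J P.natDegree := by
  refine ⟨u, v, isEmptyScheme_of_forall_field fun D _ _ x y h => ?_,
    isEmptyScheme_of_forall_field fun D _ _ x y h => ?_, ?_⟩
  · rw [vanishesAt_sup, vanishesAt_span] at h
    exact hu D x y h.1 (by simpa using h.2 _ rfl)
  · rw [vanishesAt_sup, vanishesAt_span] at h
    exact hv D x y h.1 (by simpa using h.2 _ rfl)
  set K := J ⊔ Ideal.span {xForm u - 1, yForm v - 1} with hK
  have hpt := vanishesAt_mk_X K
  rw [hK, vanishesAt_sup, vanishesAt_span] at hpt
  obtain ⟨h2, h3, h4⟩ := hgen _ _ _ hpt.1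
    (by simpa [sub_eq_zero] using hpt.2 (xForm u - 1) (Or.inl rfl))
    (by simpa [sub_eq_zero] using hpt.2 (yForm v - 1) (Or.inr rfl))
  rw [← hK] at h2 h3 h4
  have hzK : VanishesAt K (fun i => AdjoinRoot.mk P (xs i)) fun i => AdjoinRoot.mk P (ys i) := by
    rw [hK, vanishesAt_sup, vanishesAt_span]
    refine ⟨hz, ?_⟩
    rintro F (rfl | rfl)
    · rw [map_sub, aeval_xForm, hzu, map_one, sub_self]
    · rw [map_sub, aeval_yForm, hzv, map_one, sub_self]
  let f : BiRing k ⧸ K →ₐ[k] AdjoinRoot P := Ideal.Quotient.liftₐ K _ hzK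
  rw [aeval_mk_X] at h2 h3 h4
  let g : AdjoinRoot P →ₐ[k] BiRing k ⧸ K :=
    AdjoinRoot.liftAlgHom P (Algebra.ofId k _) (Ideal.Quotient.mk K T) h2
  have hg : ∀ Q : Polynomial k, g (AdjoinRoot.mk P Q) =
      Polynomial.aeval (Ideal.Quotient.mk K T) Q := fun Q => rfl
  have hf : ∀ F : BiRing k, f (Ideal.Quotient.mk K F) =
      aeval (Sum.elim (fun i => AdjoinRoot.mk P (xs i)) fun i => AdjoinRoot.mk P (ys i)) F :=
    fun F => rfl
  let e : (BiRing k ⧸ K) ≃ₐ[k] AdjoinRoot P := AlgEquiv.ofAlgHom f g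
    (by
      refine AdjoinRoot.algHom_ext ?_
      rw [AlgHom.comp_apply, ← AdjoinRoot.mk_X, hg, Polynomial.aeval_X, hf, hT, AlgHom.id_apply,
        AdjoinRoot.mk_X])
    (by
      refine Ideal.Quotient.algHom_ext k (algHom_ext fun s => ?_)
      change g (f (Ideal.Quotient.mk K (X s))) = Ideal.Quotient.mk K (X s)
      rw [hf, aeval_X]
      cases s with
      | inl i => exact (hg _).trans (h3 i)
      | inr i => exact (hg _).trans (h4 i))
  let pb := AdjoinRoot.powerBasis hP
  have hfin : Module.Finite k (AdjoinRoot P) := pb.finite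
  refine ⟨Module.Finite.equiv e.symm.toLinearEquiv, ?_⟩
  rw [e.toLinearEquiv.finrank_eq, pb.finrank, AdjoinRoot.powerBasis_dim]

/-- A subscheme whose only point is a reduced rational point has length one. -/
theorem hasLength_one {J : Ideal (BiRing k)} {u v ξ η : Fin 3 → k}
    (hu : ∀ (D : Type u) [Field D] [Algebra k D] (x y : Fin 3 → D), VanishesAt J x y →
      ∑ i, algebraMap k D (u i) * x i = 0 → x = 0 ∨ y = 0)
    (hv : ∀ (D : Type u) [Field D] [Algebra k D] (x y : Fin 3 → D), VanishesAt J x y →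
      ∑ i, algebraMap k D (v i) * y i = 0 → x = 0 ∨ y = 0)
    (hz : VanishesAt J ξ η) (hzu : ∑ i, u i * ξ i = 1) (hzv : ∑ i, v i * η i = 1)
    (hgen : ∀ (S : Type u) [CommRing S] [Algebra k S] (x y : Fin 3 → S), VanishesAt J x y →
      ∑ i, algebraMap k S (u i) * x i = 1 → ∑ i, algebraMap k S (v i) * y i = 1 →
      (∀ i, x i = algebraMap k S (ξ i)) ∧ ∀ i, y i = algebraMap k S (η i)) :
    HasLength J 1 := by
  have hC : ∀ c : k, AdjoinRoot.mk (Polynomial.X : Polynomial k) (Polynomial.C c) =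
      algebraMap k _ c := fun c => rfl
  rw [← Polynomial.natDegree_X (R := k)]
  refine hasLength_natDegree Polynomial.X_ne_zero (fun i => Polynomial.C (ξ i))
    (fun i => Polynomial.C (η i)) 0 hu hv (fun F hF => ?_) ?_ ?_ ?_ fun S _ _ x y h h1 h2 => ?_
  · have h1 : (Sum.elim (fun i => AdjoinRoot.mk (Polynomial.X : Polynomial k) (Polynomial.C (ξ i)))
        fun i => AdjoinRoot.mk Polynomial.X (Polynomial.C (η i))) =
        fun s => algebraMap k _ (Sum.elim ξ η s) := by
      funext s
      cases s <;> rfl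
    rw [h1, aeval_algebraMap_comp, ← aeval_eq_eval, hz F hF, map_zero]
  · simp_rw [hC, ← map_mul, ← map_sum, hzu, map_one]
  · simp_rw [hC, ← map_mul, ← map_sum, hzv, map_one]
  · rw [map_zero, eq_comm, ← AdjoinRoot.mk_X, AdjoinRoot.mk_self]
  · obtain ⟨h3, h4⟩ := hgen S x y h h1 h2
    simp [h3, h4]

theorem hasLength_zero {J : Ideal (BiRing k)} (hJ : IsEmptyScheme J) : HasLength J 0 := by
  have mono : ∀ {J' : Ideal (BiRing k)}, J ≤ J' → IsEmptyScheme J' := fun hle =>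
    hJ.imp fun _ h => h.trans hle
  refine ⟨Pi.single 0 1, Pi.single 0 1, mono le_sup_left, mono le_sup_left, ?_⟩
  obtain ⟨N, hN⟩ := hJ
  set K := J ⊔ Ideal.span {xForm (Pi.single 0 1 : Fin 3 → k) - 1, yForm (Pi.single 0 1) - 1}
    with hK
  have hx : (X (Sum.inl 0) - 1 : BiRing k) ∈ K := by
    refine (le_sup_right : _ ≤ K) (Ideal.subset_span (Or.inl ?_))
    simp [xForm, Pi.single_apply]
  have hy : (X (Sum.inr 0) - 1 : BiRing k) ∈ K := by
    refine (le_sup_right : _ ≤ K) (Ideal.subset_span (Or.inr ?_))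
    simp [yForm, Pi.single_apply]
  have h1 : (X (Sum.inl 0) * X (Sum.inr 0) : BiRing k) ^ N ∈ K :=
    (le_sup_left : _ ≤ K) (hN (Ideal.pow_mem_pow (Ideal.mul_mem_mul
      (Ideal.subset_span (Set.mem_range_self 0)) (Ideal.subset_span (Set.mem_range_self 0))) N))
  rw [← Ideal.Quotient.eq_zero_iff_mem, map_sub, sub_eq_zero, map_one] at hx hy
  rw [← Ideal.Quotient.eq_zero_iff_mem, map_pow, map_mul, hx, hy, one_mul, one_pow] at h1
  have : Subsingleton (BiRing k ⧸ K) := subsingleton_of_zero_eq_one h1.symm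
  exact ⟨inferInstance, Module.finrank_zero_of_subsingleton⟩

/-! ### The ideals of the graph, of the naive graph and of the torsion component -/

/-- The generic point of the graph: an element of the ideal of the graph vanishes at
`(x, t • Φ(x))` for all `x` and `t` in an arbitrary `k`-algebra. -/
theorem aeval_eq_zero_of_mem_graphIdeal [Infinite k] {φ : Fin 3 → PlaneRing k} (hφ : φ ≠ 0)
    {F : BiRing k} (hF : F ∈ graphIdeal φ) {S : Type u} [CommRing S] [Algebra k S]
    (x : Fin 3 → S) (t : S) : aeval (Sum.elim x fun j => t * aeval x (φ j)) F = 0 := by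
  obtain ⟨j, hj⟩ := Function.ne_iff.1 hφ
  set G : MvPolynomial (Option (Fin 3)) k :=
    aeval (Sum.elim (fun i => X (some i)) fun j => X none * rename some (φ j)) F with hG
  have hGev : ∀ {A : Type u} [CommRing A] [Algebra k A] (v : Option (Fin 3) → A),
      aeval v G = aeval (Sum.elim (fun i => v (some i))
        fun j => v none * aeval (fun i => v (some i)) (φ j)) F := by
    intro A _ _ v
    rw [hG, ← AlgHom.comp_apply]
    congr 1
    refine algHom_ext fun s => ?_
    cases s with
    | inl i => simp
    | inr i => simp [aeval_rename, Function.comp_def]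
  have hG0 : G = 0 := by
    have : X none * rename some (φ j) * G = 0 := by
      refine MvPolynomial.funext fun v => ?_
      rw [map_mul, map_mul, eval_X, map_zero, eval_rename]
      by_cases h1 : v none = 0
      · rw [h1, zero_mul, zero_mul]
      by_cases h2 : eval (v ∘ some) (φ j) = 0
      · rw [h2, mul_zero, zero_mul]
      have h3 := hF (Sum.elim (v ∘ some) (v none • value φ (v ∘ some)))
        ⟨v ∘ some, fun h => h2 (congrFun h j), v none, h1, rfl⟩
      have h4 : eval v G = 0 := by
        rw [← aeval_eq_eval, hGev, ← h3]
        rfl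
      rw [h4, mul_zero]
    refine (mul_eq_zero.1 this).resolve_left (mul_ne_zero (X_ne_zero _) ?_)
    rwa [Ne, map_eq_zero_iff _ (rename_injective _ (Option.some_injective _))]
  have := hGev (fun o => Option.elim o t x)
  rw [hG0, map_zero] at this
  exact this.symm

theorem minor_mem_graphIdeal (φ : Fin 3 → PlaneRing k) (i j : Fin 3) :
    X (Sum.inr i) * rename Sum.inl (φ j) - X (Sum.inr j) * rename Sum.inl (φ i)
      ∈ graphIdeal φ := by
  rintro z ⟨x, -, c, -, rfl⟩
  simp only [map_sub, map_mul, aeval_X, aeval_rename_inl, Sum.elim_inr, Pi.smul_apply, value,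
    aeval_eq_eval, smul_eq_mul]
  ring

/-- If `Ψ` is a left inverse of `Φ`, then `x` and `Ψ(y)` are proportional on the graph of `Φ`. -/
theorem inverse_minor_mem_graphIdeal {φ ψ : Fin 3 → PlaneRing k} {e : ℕ}
    (hψ : ∀ j, (ψ j).IsHomogeneous e) {h : PlaneRing k} (hh : ∀ j, bind₁ φ (ψ j) = h * X j)
    (i j : Fin 3) :
    X (Sum.inl i) * rename Sum.inr (ψ j) - X (Sum.inl j) * rename Sum.inr (ψ i)
      ∈ graphIdeal φ := by
  rintro z ⟨x, -, c, -, rfl⟩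
  have key : ∀ l, aeval (c • value φ x) (ψ l) = c ^ e * (eval x h * x l) := by
    intro l
    have h1 := congrArg (eval x) (hh l)
    rw [← aeval_eq_eval, aeval_bind₁] at h1
    rw [show c • value φ x = fun i => c * aeval x (φ i) from rfl,
      aeval_mul_of_isHomogeneous (hψ l), h1, map_mul, aeval_X, aeval_eq_eval]
  simp only [map_sub, map_mul, aeval_X, aeval_rename_inr, Sum.elim_inl, key]
  ring

/-- If `Ψ` is a right inverse of `Φ`, then an element of the ideal of the graph of `Φ` vanishes at
`(s • Ψ(y), y)` for all `y` and `s` in an arbitrary `k`-algebra. -/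
theorem aeval_inverse_eq_zero_of_mem_graphIdeal [Infinite k] {φ ψ : Fin 3 → PlaneRing k} {n : ℕ}
    (hφn : ∀ j, (φ j).IsHomogeneous n) {g : PlaneRing k} (hg : g ≠ 0)
    (hgψ : ∀ j, bind₁ ψ (φ j) = g * X j) {F : BiRing k} (hF : F ∈ graphIdeal φ)
    {S : Type u} [CommRing S] [Algebra k S] (y : Fin 3 → S) (s : S) :
    aeval (Sum.elim (fun i => s * aeval y (ψ i)) y) F = 0 := by
  have hφ : φ ≠ 0 := by
    rintro rfl
    have := hgψ 0
    rw [Pi.zero_apply, map_zero] at this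
    exact mul_ne_zero hg (X_ne_zero _) this.symm
  set G : MvPolynomial (Option (Fin 3)) k :=
    aeval (Sum.elim (fun i => X none * rename some (ψ i)) fun j => X (some j)) F with hG
  have hGev : ∀ {A : Type u} [CommRing A] [Algebra k A] (v : Option (Fin 3) → A),
      aeval v G = aeval (Sum.elim (fun i => v none * aeval (fun i => v (some i)) (ψ i))
        fun j => v (some j)) F := by
    intro A _ _ v
    rw [hG, ← AlgHom.comp_apply]
    congr 1
    refine algHom_ext fun s => ?_
    cases s with
    | inl i => simp [aeval_rename, Function.comp_def]
    | inr i => simp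
  have hG0 : G = 0 := by
    let E := MvPolynomial (Option (Fin 3)) k
    let L := FractionRing E
    have hinj : Function.Injective (algebraMap E L) := IsFractionRing.injective E L
    let v : Option (Fin 3) → L := fun o => algebraMap E L (X o)
    have hv : ∀ f : E, aeval v f = algebraMap E L f := fun f => by
      rw [show v = algebraMap E L ∘ X from rfl, aeval_algebraMap_apply, aeval_X_left_apply]
    have hvs : ∀ f : PlaneRing k,
        aeval (fun i => v (some i)) f = algebraMap E L (rename some f) := fun f => by
      rw [← hv, aeval_rename]
      rfl
    have hs : v none ≠ 0 := by
      rw [Ne, map_eq_zero_iff _ hinj]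
      exact X_ne_zero _
    have hgL : aeval (fun i => v (some i)) g ≠ 0 := by
      rw [hvs, Ne, map_eq_zero_iff _ hinj,
        map_eq_zero_iff _ (rename_injective _ (Option.some_injective _))]
      exact hg
    have hval : ∀ j, aeval (fun i => v none * aeval (fun i => v (some i)) (ψ i)) (φ j) =
        v none ^ n * (aeval (fun i => v (some i)) g * v (some j)) := by
      intro j
      have := congrArg (aeval fun i => v (some i)) (hgψ j)
      rw [aeval_bind₁, map_mul, aeval_X] at this
      rw [aeval_mul_of_isHomogeneous (hφn j), this]
    have h0 := aeval_eq_zero_of_mem_graphIdeal hφ hF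
      (fun i => v none * aeval (fun i => v (some i)) (ψ i))
      (v none ^ n * aeval (fun i => v (some i)) g)⁻¹
    have hy : (fun j => (v none ^ n * aeval (fun i => v (some i)) g)⁻¹ *
        aeval (fun i => v none * aeval (fun i => v (some i)) (ψ i)) (φ j)) =
        fun j => v (some j) := by
      funext j
      rw [hval, ← mul_assoc (v none ^ n),
        inv_mul_cancel_left₀ (mul_ne_zero (pow_ne_zero _ hs) hgL)]
    rw [hy, ← hGev, hv, map_eq_zero_iff _ hinj] at h0
    exact h0
  have := hGev (fun o => Option.elim o s y)
  rw [hG0, map_zero] at this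
  exact this.symm

theorem toSym_rename_inl (φ : Fin 3 → PlaneRing k) (f : PlaneRing k) :
    toSym φ (rename Sum.inl f) =
      algebraMap (PlaneRing k) (SymmetricAlgebra (PlaneRing k) (baseIdeal φ)) f := by
  have : (toSym φ).comp (rename Sum.inl : PlaneRing k →ₐ[k] BiRing k).toRingHom =
      algebraMap (PlaneRing k) (SymmetricAlgebra (PlaneRing k) (baseIdeal φ)) := by
    refine ringHom_ext (fun c => ?_) fun i => ?_ <;> simp [toSym]
  exact DFunLike.congr_fun this f

theorem toSym_X_inr (φ : Fin 3 → PlaneRing k) (j : Fin 3) :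
    toSym φ (X (Sum.inr j)) = SymmetricAlgebra.ι (PlaneRing k) (baseIdeal φ)
      ⟨φ j, Ideal.subset_span (Set.mem_range_self j)⟩ := by
  simp [toSym]

theorem syzygy_mem_naiveGraphIdeal {φ s : Fin 3 → PlaneRing k} (h : ∑ j, s j * φ j = 0) :
    ∑ j, rename Sum.inl (s j) * X (Sum.inr j) ∈ naiveGraphIdeal φ := by
  rw [naiveGraphIdeal, RingHom.mem_ker, map_sum]
  simp_rw [map_mul, toSym_rename_inl, toSym_X_inr, ← Algebra.smul_def, ← map_smul, ← map_sum]
  rw [show (∑ j, s j • (⟨φ j, Ideal.subset_span (Set.mem_range_self j)⟩ : baseIdeal φ)) = 0 from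
    Subtype.ext (by simpa using h), map_zero]

theorem minor_mem_naiveGraphIdeal (φ : Fin 3 → PlaneRing k) (i j : Fin 3) :
    X (Sum.inr i) * rename Sum.inl (φ j) - X (Sum.inr j) * rename Sum.inl (φ i)
      ∈ naiveGraphIdeal φ := by
  rw [naiveGraphIdeal, RingHom.mem_ker, map_sub, map_mul, map_mul, sub_eq_zero, mul_comm,
    mul_comm (toSym φ (X (Sum.inr j)))]
  simp_rw [toSym_rename_inl, toSym_X_inr, ← Algebra.smul_def, ← map_smul]
  congr 1
  exact Subtype.ext (mul_comm _ _)

/-- The ideal of the naive graph is generated by the syzygies of `φ`: a ring homomorphism kills it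
as soon as it kills the linear forms in `y` given by the syzygies. -/
theorem naiveGraphIdeal_le_ker {φ : Fin 3 → PlaneRing k} {S : Type*} [CommRing S]
    (f : BiRing k →+* S)
    (h : ∀ s : Fin 3 → PlaneRing k, ∑ j, s j * φ j = 0 →
      ∑ j, f (rename Sum.inl (s j)) * f (X (Sum.inr j)) = 0) :
    naiveGraphIdeal φ ≤ RingHom.ker f := by
  let _ : Algebra (PlaneRing k) S :=
    (f.comp (rename Sum.inl : PlaneRing k →ₐ[k] BiRing k).toRingHom).toAlgebra
  have halg : ∀ p : PlaneRing k, algebraMap (PlaneRing k) S p = f (rename Sum.inl p) :=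
    fun p => rfl
  let v : Fin 3 → baseIdeal φ := fun j => ⟨φ j, Ideal.subset_span (Set.mem_range_self j)⟩
  let π : (Fin 3 → PlaneRing k) →ₗ[PlaneRing k] baseIdeal φ :=
    Fintype.linearCombination (PlaneRing k) v
  let L : (Fin 3 → PlaneRing k) →ₗ[PlaneRing k] S :=
    Fintype.linearCombination (PlaneRing k) fun j => f (X (Sum.inr j))
  have hπ : Function.Surjective π := by
    rintro ⟨p, hp⟩
    obtain ⟨c, hc⟩ := Submodule.mem_span_range_iff_exists_fun _ |>.1 hp
    exact ⟨c, Subtype.ext (by simpa [π, v, Fintype.linearCombination_apply] using hc)⟩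
  have hker : LinearMap.ker π ≤ LinearMap.ker L := by
    intro s hs
    rw [LinearMap.mem_ker] at hs ⊢
    have hs' : ∑ j, s j * φ j = 0 := by
      simpa [π, v, Fintype.linearCombination_apply] using congrArg Subtype.val hs
    simpa [L, Fintype.linearCombination_apply, Algebra.smul_def, halg] using h s hs'
  let l : baseIdeal φ →ₗ[PlaneRing k] S :=
    (LinearMap.ker π).liftQ L hker ∘ₗ (π.quotKerEquivOfSurjective hπ).symm.toLinearMap
  have hl : ∀ j, l (v j) = f (X (Sum.inr j)) := by
    intro j
    have hv : v j = π (Pi.single j 1) := by simp [π]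
    have : (π.quotKerEquivOfSurjective hπ).symm (v j) = (LinearMap.ker π).mkQ (Pi.single j 1) := by
      rw [LinearEquiv.symm_apply_eq, hv]
      rfl
    simp only [l, LinearMap.comp_apply, LinearEquiv.coe_coe, this]
    simp [L]
  have hcomp : (SymmetricAlgebra.lift l : _ →ₐ[PlaneRing k] S).toRingHom.comp (toSym φ) = f := by
    refine ringHom_ext (fun c => ?_) fun s => ?_
    · simp [toSym, halg]
    · cases s with
      | inl i => simp [toSym, halg]
      | inr j =>
        rw [← hl j, RingHom.comp_apply]
        simp [toSym, v]
  intro F hF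
  rw [RingHom.mem_ker, ← hcomp, RingHom.comp_apply, (show toSym φ F = 0 from hF), map_zero]

theorem naiveGraphIdeal_le_torsionIdeal (φ : Fin 3 → PlaneRing k) :
    naiveGraphIdeal φ ≤ torsionIdeal φ :=
  le_trans (fun _ hF => Submodule.mem_colon.2 fun _ _ => Ideal.mul_mem_right _ _ hF)
    (le_iSup (fun m : ℕ => (naiveGraphIdeal φ).colon
      ((graphIdeal φ ^ m : Ideal (BiRing k)) : Set (BiRing k))) 0)

theorem mem_torsionIdeal_of_forall_mul_mem {φ : Fin 3 → PlaneRing k} {D : BiRing k}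
    (h : ∀ F ∈ graphIdeal φ, D * F ∈ naiveGraphIdeal φ) : D ∈ torsionIdeal φ := by
  refine (le_iSup (fun m : ℕ => (naiveGraphIdeal φ).colon
      ((graphIdeal φ ^ m : Ideal (BiRing k)) : Set (BiRing k))) 1) (Submodule.mem_colon.2 ?_)
  intro F hF
  rw [pow_one] at hF
  exact h F hF

theorem exists_pow_mul_mem_of_fg {A : Type*} [CommRing A] {J K : Ideal A} (hJ : J.FG) (f : A)
    (h : ∀ F ∈ J, ∃ e : ℕ, f ^ e * F ∈ K) : ∃ e : ℕ, ∀ F ∈ J, f ^ e * F ∈ K := by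
  obtain ⟨s, rfl⟩ := hJ
  choose! e he using h
  refine ⟨s.sup e, fun F hF => ?_⟩
  induction hF using Submodule.span_induction with
  | mem F hF =>
    obtain ⟨c, hc⟩ := Nat.exists_eq_add_of_le (Finset.le_sup (f := e) hF)
    rw [hc, pow_add, mul_right_comm]
    exact K.mul_mem_right _ (he F (Ideal.subset_span hF))
  | zero => rw [mul_zero]; exact K.zero_mem
  | add F G _ _ hF hG => rw [mul_add]; exact K.add_mem hF hG
  | smul a F _ hF => rw [smul_eq_mul, mul_left_comm]; exact K.mul_mem_left _ hF

/-- If `F` vanishes at all points of `K` where `D` is invertible, then a power of `D` multiplies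
`F` into `K`. -/
theorem exists_pow_mul_mem_of_forall_isUnit {K : Ideal (BiRing k)} {D F : BiRing k}
    (h : ∀ (S : Type u) [CommRing S] [Algebra k S] (x y : Fin 3 → S),
      VanishesAt K x y → IsUnit (aeval (Sum.elim x y) D) →
      aeval (Sum.elim x y) F = 0) : ∃ e : ℕ, D ^ e * F ∈ K := by
  let D' := Ideal.Quotient.mk K D
  let S := Localization.Away D'
  have key : ∀ G : BiRing k, aeval (Sum.elim
      (fun i => algebraMap (BiRing k ⧸ K) S (Ideal.Quotient.mk K (X (Sum.inl i))))
      (fun i => algebraMap (BiRing k ⧸ K) S (Ideal.Quotient.mk K (X (Sum.inr i))))) G =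
      algebraMap (BiRing k ⧸ K) S (Ideal.Quotient.mk K G) := by
    intro G
    rw [← aeval_mk_X K G, ← aeval_algebraMap_apply]
    congr 2
    ext s
    cases s <;> rfl
  have h0 := h S _ _ (fun G hG => by
    rw [key, Ideal.Quotient.eq_zero_iff_mem.2 hG, map_zero]) (by
    rw [key]; exact IsLocalization.Away.algebraMap_isUnit D')
  rw [key, IsLocalization.map_eq_zero_iff (Submonoid.powers D') S] at h0
  obtain ⟨⟨_, e, rfl⟩, he⟩ := h0
  exact ⟨e, Ideal.Quotient.eq_zero_iff_mem.1 (by simpa [D'] using he)⟩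

/-- The torsion component lies over the base locus. -/
theorem exists_pow_mem_torsionIdeal [Infinite k] {φ : Fin 3 → PlaneRing k} (hφ : φ ≠ 0)
    (j : Fin 3) : ∃ e : ℕ, rename Sum.inl (φ j) ^ e ∈ torsionIdeal φ := by
  obtain ⟨e, he⟩ := exists_pow_mul_mem_of_fg (IsNoetherian.noetherian (graphIdeal φ))
    (K := naiveGraphIdeal φ) (rename Sum.inl (φ j)) fun F hF =>
      exists_pow_mul_mem_of_forall_isUnit fun S _ _ x y hK hD => by
        rw [aeval_rename_inl] at hD
        obtain ⟨w, hw⟩ := hD.exists_right_inv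
        -- Where `φ j` is invertible, `y` is the multiple of `Φ(x)` by `y j / φ j (x)`.
        have hy : y = fun i => y j * w * aeval x (φ i) := by
          funext i
          have := hK _ (minor_mem_naiveGraphIdeal φ i j)
          simp only [map_sub, map_mul, aeval_X, aeval_rename_inl, Sum.elim_inr] at this
          linear_combination w * this - y i * hw
        rw [hy]
        exact aeval_eq_zero_of_mem_graphIdeal hφ hF x _
  exact ⟨e, mem_torsionIdeal_of_forall_mul_mem he⟩

/-- A point of the naive graph with coordinates in a `k`-algebra lies on the torsion component if
some element of the ideal of the graph is invertible there. -/
theorem vanishesAt_torsionIdeal {S : Type*} [CommRing S] [Algebra k S]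
    {φ : Fin 3 → PlaneRing k} {x y : Fin 3 → S}
    (h : VanishesAt (naiveGraphIdeal φ) x y) {W : BiRing k} (hW : W ∈ graphIdeal φ)
    (hu : IsUnit (aeval (Sum.elim x y) W)) : VanishesAt (torsionIdeal φ) x y := by
  rw [vanishesAt_iff_le_ker, torsionIdeal, saturation, iSup_le_iff]
  intro l F hF
  have h1 := h _ (Submodule.mem_colon.1 hF (W ^ l) (Ideal.pow_mem_pow hW l))
  rw [smul_eq_mul, map_mul, map_pow] at h1
  exact (hu.pow l).mul_left_eq_zero.1 h1

/-! ### Base ideals of height two -/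

theorem ne_zero_of_two_le_height {φ : Fin 3 → PlaneRing k} (h : 2 ≤ (baseIdeal φ).height) :
    φ ≠ 0 := by
  rintro rfl
  rw [baseIdeal, show Set.range (0 : Fin 3 → PlaneRing k) = {0} from Set.range_const,
    Ideal.span_singleton_zero, Ideal.height_bot] at h
  exact absurd h (by norm_num)

/-- If the entries of `φ` generate an ideal of height two, they have no common factor, so that a
vector proportional to `φ` is a polynomial multiple of `φ`. -/
theorem exists_eq_mul_of_two_le_height {φ v : Fin 3 → PlaneRing k}
    (h : 2 ≤ (baseIdeal φ).height) (hv : ∀ i j, v i * φ j = v j * φ i) :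
    ∃ c : PlaneRing k, ∀ i, v i = c * φ i := by
  classical
  obtain ⟨l, hl⟩ := Function.ne_iff.1 (ne_zero_of_two_le_height h)
  let _ : StrongNormalizationMonoid (PlaneRing k) :=
    UniqueFactorizationMonoid.strongNormalizationMonoid
  let _ : NormalizedGCDMonoid (PlaneRing k) :=
    UniqueFactorizationMonoid.toNormalizedGCDMonoid (PlaneRing k)
  set g := Finset.univ.gcd φ with hg
  have hgu : IsUnit g := by
    by_contra hgu
    have hg0 : g ≠ 0 := fun h0 => hl (Finset.gcd_eq_zero_iff.1 h0 l (Finset.mem_univ l))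
    have hle : baseIdeal φ ≤ Ideal.span {g} := by
      rw [baseIdeal, Ideal.span_le]
      rintro _ ⟨j, rfl⟩
      exact Ideal.mem_span_singleton.2 (Finset.gcd_dvd (Finset.mem_univ j))
    have := (h.trans (Ideal.height_mono hle)).trans (Ideal.height_span_singleton_le_one hgu)
    exact absurd this (by norm_num)
  have hdvd : φ l ∣ v l := by
    have h1 : φ l ∣ Finset.univ.gcd fun j => v l * φ j :=
      Finset.dvd_gcd fun j _ => ⟨v j, by rw [hv l j, mul_comm]⟩
    exact hgu.dvd_mul_right.1 (h1.trans (Finset.gcd_mul_left' _ _ (v l)).dvd)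
  obtain ⟨c, hc⟩ := hdvd
  refine ⟨c, fun i => mul_right_cancel₀ hl ?_⟩
  rw [hv i l, hc]
  ring

/-- Over an ideal of height two generated by the `2`-minors of a `3 × 2` matrix, the two columns
of the matrix generate the syzygies of the minors. -/
theorem syzygy_eq_combination {v p s : Fin 3 → PlaneRing k}
    (h : 2 ≤ (baseIdeal (crossProduct v p)).height)
    (hs : ∑ j, s j * crossProduct v p j = 0) :
    ∃ α β : PlaneRing k, ∀ j, s j = α * v j + β * p j := by
  obtain ⟨l, hl⟩ := Function.ne_iff.1 (ne_zero_of_two_le_height h)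
  simp only [Fin.sum_univ_three, cross_apply, Matrix.cons_val_zero, Matrix.cons_val_one,
    Matrix.cons_val] at hs
  obtain ⟨α, hα⟩ := exists_eq_mul_of_two_le_height (v := crossProduct s p) h fun i j => by
    fin_cases i <;> fin_cases j <;> simp [cross_apply]
    · linear_combination p 2 * hs
    · linear_combination (-p 1) * hs
    · linear_combination (-p 2) * hs
    · linear_combination p 0 * hs
    · linear_combination p 1 * hs
    · linear_combination (-p 0) * hs
  obtain ⟨β, hβ⟩ := exists_eq_mul_of_two_le_height (v := crossProduct v s) h fun i j => by
    fin_cases i <;> fin_cases j <;> simp [cross_apply]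
    · linear_combination (-v 2) * hs
    · linear_combination v 1 * hs
    · linear_combination v 2 * hs
    · linear_combination (-v 0) * hs
    · linear_combination (-v 1) * hs
    · linear_combination v 0 * hs
  refine ⟨α, β, fun j => ?_⟩
  -- The difference of both sides is parallel to both columns, which are independent.
  have h1 : ∀ i, crossProduct (fun j => s j - (α * v j + β * p j)) p i = 0 := fun i => by
    have := hα i
    fin_cases i <;> simp [cross_apply] at this ⊢ <;> linear_combination this
  have h2 : ∀ i, crossProduct v (fun j => s j - (α * v j + β * p j)) i = 0 := fun i => by
    have := hβ i
    fin_cases i <;> simp [cross_apply] at this ⊢ <;> linear_combination this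
  generalize hd : (fun j => s j - (α * v j + β * p j)) = d at h1 h2
  have h3 : d j = 0 := by
    refine (mul_eq_zero.1 ?_).resolve_left hl
    have hid : crossProduct v p l * d j = v j * crossProduct d p l + p j * crossProduct v d l -
        if l = j then ∑ i, v i * crossProduct d p i else 0 := by
      fin_cases l <;> fin_cases j <;> simp [cross_apply, Fin.sum_univ_three] <;> ring
    simp [hid, h1, h2]
  rw [← hd] at h3
  linear_combination h3

/-- A general line does not meet the base locus. -/
theorem exists_general_line {φ : Fin 3 → PlaneRing k} {n : ℕ} (hφn : ∀ j, (φ j).IsHomogeneous n)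
    (h : 2 ≤ (baseIdeal φ).height) :
    ∃ G : PlaneRing k, G ≠ 0 ∧ ∀ a : Fin 3 → k, eval a G ≠ 0 →
      ∀ (D : Type u) [Field D] [Algebra k D] (x : Fin 3 → D), (∀ j, aeval x (φ j) = 0) →
        ∑ i, algebraMap k D (a i) * x i = 0 → x = 0 := by
  classical
  have hfin := (baseIdeal φ).finite_minimalPrimes_of_isNoetherianRing
  -- For each minimal prime other than the irrelevant ideal, the linear forms that it contains
  -- satisfy a nontrivial linear equation.
  have hlin : ∀ P : Ideal (PlaneRing k), ∃ c : Fin 3 → k, c ≠ 0 ∧ ((∃ i, X i ∉ P) →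
      ∀ a : Fin 3 → k, ∑ i, C (a i) * X i ∈ P → ∑ i, c i * a i = 0) := by
    intro P
    by_cases hP : ∃ i, X i ∉ P
    swap
    · exact ⟨1, one_ne_zero, fun h => absurd h hP⟩
    obtain ⟨i, hi⟩ := hP
    let V : Submodule k (Fin 3 → k) := (P.restrictScalars k).comap
      (Fintype.linearCombination k (fun i => (X i : PlaneRing k)))
    have hV : ∀ a, a ∈ V ↔ ∑ i, C (a i) * X i ∈ P := fun a => by
      simp [V, Fintype.linearCombination_apply, smul_eq_C_mul]
    have hlt : V < ⊤ := by
      refine lt_top_iff_ne_top.2 fun htop => hi ?_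
      have := (hV (Pi.single i 1)).1 (htop ▸ Submodule.mem_top)
      simpa [Pi.single_apply] using this
    obtain ⟨f, hf0, hf⟩ := Submodule.exists_le_ker_of_lt_top V hlt
    have hfa : ∀ a, f a = ∑ i, f (Pi.single i 1) * a i := fun a => by
      conv_lhs => rw [LinearMap.pi_apply_eq_sum_univ f a]
      exact Finset.sum_congr rfl fun j _ => by
        rw [smul_eq_mul, mul_comm]
        congr 2
        ext
        simp [Pi.single_apply, eq_comm]
    refine ⟨fun i => f (Pi.single i 1), fun h0 => hf0 (LinearMap.ext fun a => ?_), fun _ a ha => ?_⟩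
    · rw [hfa, LinearMap.zero_apply]
      exact Finset.sum_eq_zero fun j _ => by rw [congrFun h0 j, Pi.zero_apply, zero_mul]
    · rw [← hfa]
      exact hf ((hV a).2 ha)
  choose c hc0 hc using hlin
  refine ⟨∏ P ∈ hfin.toFinset, ∑ i, C (c P i) * X i, ?_, ?_⟩
  · refine Finset.prod_ne_zero_iff.2 fun P _ h0 => hc0 P (funext fun i => ?_)
    have := congrArg (eval (Pi.single i 1)) h0
    simpa [Pi.single_apply] using this
  intro a ha D _ _ x hx hax
  by_contra hx0
  obtain ⟨i, hi⟩ := Function.ne_iff.1 hx0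
  -- The prime ideal of all homogeneous relations between the coordinates of `x`.
  let f : PlaneRing k →ₐ[k] Polynomial D := aeval fun i => Polynomial.X * Polynomial.C (x i)
  let q := RingHom.ker f
  have hq : q.IsPrime := RingHom.ker_isPrime _
  let m := RingHom.ker (constantCoeff : PlaneRing k →+* k)
  have hm : m.IsPrime := RingHom.ker_isPrime _
  have hf : ∀ g : PlaneRing k, ∀ d, g.IsHomogeneous d → aeval x g = 0 → g ∈ q := by
    intro g d hgd hg
    change f g = 0
    have h1 : aeval (fun i => Polynomial.C (x i)) g = Polynomial.C (aeval x g) := by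
      rw [show (fun i => Polynomial.C (x i)) = algebraMap D (Polynomial D) ∘ x from rfl,
        aeval_algebraMap_apply]
      rfl
    rw [show f g = _ from aeval_mul_of_isHomogeneous hgd _ _, h1, hg, map_zero, mul_zero]
  have hXi : X i ∉ q := by
    intro h0
    have h1 : f (X i) = 0 := h0
    simp only [f, aeval_X] at h1
    exact mul_ne_zero Polynomial.X_ne_zero (Polynomial.C_ne_zero.2 hi) h1
  have hqm : q < m := by
    refine lt_of_le_of_ne (fun g hg => ?_) fun h0 => hXi (h0 ▸ ?_)
    · have h1 : f g = 0 := hg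
      have h2 : (Polynomial.aeval (0 : D)).restrictScalars k (f g) = algebraMap k D (constantCoeff g) := by
        rw [← AlgHom.comp_apply]
        have : ((Polynomial.aeval (0 : D)).restrictScalars k).comp f =
            aeval fun _ => (0 : D) := algHom_ext fun i => by simp [f]
        rw [this, show (fun _ : Fin 3 => (0 : D)) = 0 from rfl, aeval_zero]
      rw [h1, map_zero, eq_comm, map_eq_zero_iff _ (algebraMap k D).injective] at h2
      exact h2
    · change constantCoeff (X i : PlaneRing k) = 0
      simp
  have hIq : baseIdeal φ ≤ q := by
    rw [baseIdeal, Ideal.span_le]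
    rintro _ ⟨j, rfl⟩
    exact hf _ _ (hφn j) (hx j)
  have haq : ∑ i, C (a i) * X i ∈ q := by
    refine hf _ 1 (IsHomogeneous.sum _ _ _ fun i _ => isHomogeneous_C_mul_X _ _) ?_
    simpa using hax
  obtain ⟨P, hP, hPq⟩ := Ideal.exists_minimalPrimes_le hIq
  have hPprime := hP.isPrime
  have haP : ∑ i, C (a i) * X i ∉ P := by
    intro h0
    have h1 := hc P ⟨i, fun h1 => hXi (hPq h1)⟩ a h0
    refine ha ?_
    rw [map_prod]
    exact Finset.prod_eq_zero (hfin.mem_toFinset.2 hP) (by simpa using h1)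
  have hPlt : P < q := lt_of_le_of_ne hPq fun h0 => haP (h0 ▸ haq)
  have h2 : 2 ≤ P.height := h.trans (Ideal.height_mono hP.1.2)
  have h3 := Ideal.height_add_one_le_of_lt_of_isPrime hPlt
  have h4 := Ideal.height_add_one_le_of_lt_of_isPrime hqm
  have h5 : m.height ≤ 3 := by
    have h6 := Ideal.height_le_ringKrullDim_of_ne_top hm.ne_top
    rw [MvPolynomial.ringKrullDim_of_isNoetherianRing, ringKrullDim_eq_zero_of_field, zero_add,
      Nat.card_fin] at h6
    exact WithBot.coe_le_coe.1 h6
  have h7 : (4 : ℕ∞) ≤ 3 := calc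
    (4 : ℕ∞) = 2 + 1 + 1 := by norm_num
    _ ≤ P.height + 1 + 1 := by gcongr
    _ ≤ q.height + 1 := by gcongr
    _ ≤ m.height := h4
    _ ≤ 3 := h5
  exact absurd h7 (by norm_num)

/-! ### General points and general lines -/

theorem exists_cross_eval_ne_zero [Infinite k] {G : PlaneRing k} (hG : G ≠ 0) :
    ∃ a z : Fin 3 → k, z ≠ 0 ∧ eval (crossProduct a z) G ≠ 0 := by
  obtain ⟨ξ, hξ⟩ : ∃ ξ, eval ξ G ≠ 0 := by
    by_contra! h0
    exact hG (MvPolynomial.funext fun ξ => by rw [h0 ξ, map_zero])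
  obtain ⟨z, hz, hξz⟩ := exists_ne_zero_dot_eq_zero ξ
  obtain ⟨a, rfl⟩ := exists_cross_eq hz hξz
  exact ⟨a, z, hz, hξ⟩

theorem generalSectionLength_zero_two [Infinite k] {J : Ideal (BiRing k)} {d : ℕ}
    {G : PlaneRing k} (hG : G ≠ 0)
    (h : ∀ b : Fin 2 → Fin 3 → k, eval (crossProduct (b 0) (b 1)) G ≠ 0 →
      HasLength (J ⊔ Ideal.span (Set.range fun s => yForm (b s))) d) :
    GeneralSectionLength J 0 2 d := by
  obtain ⟨F, hev⟩ : ∃ F : MvPolynomial ((Fin 0 × Fin 3) ⊕ (Fin 2 × Fin 3)) k,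
      ∀ (a : Fin 0 → Fin 3 → k) (b : Fin 2 → Fin 3 → k),
        eval (Sum.elim (fun s => a s.1 s.2) fun s => b s.1 s.2) F =
          eval (crossProduct (b 0) (b 1)) G := by
    refine ⟨aeval (crossProduct (fun i => X (Sum.inr (0, i))) fun i => X (Sum.inr (1, i))) G,
      fun a b => ?_⟩
    rw [← aeval_eq_eval, ← AlgHom.comp_apply, ← aeval_eq_eval]
    congr 1
    refine algHom_ext fun i => ?_
    fin_cases i <;> simp [cross_apply]
  refine ⟨F, fun h0 => ?_, fun a b hab => ?_⟩
  rotate_left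
  · rw [hev] at hab
    rw [Set.range_eq_empty, Ideal.span_empty, sup_bot_eq]
    exact h b hab
  · obtain ⟨a, z, -, hne⟩ := exists_cross_eval_ne_zero hG
    refine hne ?_
    have := hev (fun _ => 0) ![a, z]
    rw [h0, map_zero] at this
    exact this.symm

theorem generalSectionLength_two_zero [Infinite k] {J : Ideal (BiRing k)} {d : ℕ}
    {G : PlaneRing k} (hG : G ≠ 0)
    (h : ∀ a : Fin 2 → Fin 3 → k, eval (crossProduct (a 0) (a 1)) G ≠ 0 →
      HasLength (J ⊔ Ideal.span (Set.range fun s => xForm (a s))) d) :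
    GeneralSectionLength J 2 0 d := by
  obtain ⟨F, hev⟩ : ∃ F : MvPolynomial ((Fin 2 × Fin 3) ⊕ (Fin 0 × Fin 3)) k,
      ∀ (a : Fin 2 → Fin 3 → k) (b : Fin 0 → Fin 3 → k),
        eval (Sum.elim (fun s => a s.1 s.2) fun s => b s.1 s.2) F =
          eval (crossProduct (a 0) (a 1)) G := by
    refine ⟨aeval (crossProduct (fun i => X (Sum.inl (0, i))) fun i => X (Sum.inl (1, i))) G,
      fun a b => ?_⟩
    rw [← aeval_eq_eval, ← AlgHom.comp_apply, ← aeval_eq_eval]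
    congr 1
    refine algHom_ext fun i => ?_
    fin_cases i <;> simp [cross_apply]
  refine ⟨F, fun h0 => ?_, fun a b hab => ?_⟩
  rotate_left
  · rw [hev] at hab
    rw [Set.range_eq_empty (fun s => yForm (b s)), Ideal.span_empty, sup_bot_eq]
    exact h a hab
  · obtain ⟨a, z, -, hne⟩ := exists_cross_eval_ne_zero hG
    refine hne ?_
    have := hev ![a, z] (fun _ => 0)
    rw [h0, map_zero] at this
    exact this.symm

/-- A basis `e₁`, `e₂` of the plane `a₀ x₀ + a₁ x₁ + a₂ x₂ = 0` that contains the given vector `e₂`,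
and the dual coordinates `u`, `w`. -/
theorem exists_line_coordinates {a e₂ : Fin 3 → k} (ha : a ≠ 0) (he : e₂ ≠ 0)
    (hae : ∑ i, a i * e₂ i = 0) :
    ∃ e₁ u w : Fin 3 → k, ∑ i, a i * e₁ i = 0 ∧ ∑ i, u i * e₁ i = 1 ∧ ∑ i, u i * e₂ i = 0 ∧
      ∑ i, w i * e₁ i = 0 ∧ ∑ i, w i * e₂ i = 1 ∧
      ∀ {S : Type u} [CommRing S] [Algebra k S] (x : Fin 3 → S),
        ∑ i, algebraMap k S (a i) * x i = 0 → ∀ i,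
          x i = (∑ j, algebraMap k S (u j) * x j) * algebraMap k S (e₁ i) +
            (∑ j, algebraMap k S (w j) * x j) * algebraMap k S (e₂ i) := by
  obtain ⟨w, hw⟩ := exists_dot_eq_one he
  obtain ⟨e₃, he₃⟩ := exists_dot_eq_one ha
  simp only [Fin.sum_univ_three] at hw he₃ hae
  -- The vector `f` satisfies `a ⬝ f = 1` and `w ⬝ f = 0`.
  set f : Fin 3 → k := fun i => e₃ i - (∑ j, w j * e₃ j) * e₂ i with hf
  have hef : e₃ = fun i => f i + (∑ j, w j * e₃ j) * e₂ i := by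
    funext i
    simp [hf]
  have haf : a 0 * f 0 + a 1 * f 1 + a 2 * f 2 = 1 := by
    simp only [hf]
    linear_combination he₃ - (∑ j, w j * e₃ j) * hae
  have hwf : w 0 * f 0 + w 1 * f 1 + w 2 * f 2 = 0 := by
    simp only [hf, Fin.sum_univ_three]
    linear_combination -(w 0 * e₃ 0 + w 1 * e₃ 1 + w 2 * e₃ 2) * hw
  clear_value f
  let E : Matrix (Fin 3) (Fin 3) k :=
    Matrix.of ![crossProduct a w, e₂, f]
  let U : Matrix (Fin 3) (Fin 3) k := Matrix.of ![crossProduct f e₂, w, a]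
  have hUE : U * E.transpose = 1 := by
    ext i j
    fin_cases i <;> fin_cases j <;>
      simp [U, E, Matrix.mul_apply, Fin.sum_univ_three, cross_apply]
    · linear_combination (w 0 * e₂ 0 + w 1 * e₂ 1 + w 2 * e₂ 2) * haf -
        (a 0 * e₂ 0 + a 1 * e₂ 1 + a 2 * e₂ 2) * hwf + hw
    · ring
    · ring
    · ring
    · linear_combination hw
    · linear_combination hwf
    · ring
    · linear_combination hae
    · linear_combination haf
  have hEU := mul_eq_one_comm.1 hUE
  have hU : ∀ i j, ∑ l, U i l * E j l = if i = j then 1 else 0 := fun i j => by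
    have := congrFun (congrFun hUE i) j
    rwa [Matrix.mul_apply, Matrix.one_apply] at this
  have hE : ∀ i j, ∑ l, E l i * U l j = if i = j then 1 else 0 := fun i j => by
    have := congrFun (congrFun hEU i) j
    rwa [Matrix.mul_apply, Matrix.one_apply] at this
  refine ⟨E 0, U 0, U 1, hU 2 0, hU 0 0, hU 0 1, hU 1 0, hU 1 1, ?_⟩
  intro S _ _ x hx i
  have hx' : ∑ j, algebraMap k S (U 2 j) * x j = 0 := hx
  have h1 : ∀ j, algebraMap k S (E 0 i) * algebraMap k S (U 0 j) +
      algebraMap k S (E 1 i) * algebraMap k S (U 1 j) +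
      algebraMap k S (E 2 i) * algebraMap k S (U 2 j) = if i = j then 1 else 0 := fun j => by
    rw [← map_mul, ← map_mul, ← map_mul, ← map_add, ← map_add, ← Fin.sum_univ_three
      (fun l => E l i * U l j), hE]
    split_ifs <;> simp
  change x i = (∑ j, algebraMap k S (U 0 j) * x j) * algebraMap k S (E 0 i) +
    (∑ j, algebraMap k S (U 1 j) * x j) * algebraMap k S (E 1 i)
  calc x i = ∑ j, (if i = j then 1 else 0) * x j := by simp
    _ = ∑ j, (algebraMap k S (E 0 i) * (algebraMap k S (U 0 j) * x j) +
          algebraMap k S (E 1 i) * (algebraMap k S (U 1 j) * x j) +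
          algebraMap k S (E 2 i) * (algebraMap k S (U 2 j) * x j)) :=
        Finset.sum_congr rfl fun j _ => by rw [← h1 j]; ring
    _ = _ := by
        rw [Finset.sum_add_distrib, Finset.sum_add_distrib, ← Finset.mul_sum, ← Finset.mul_sum,
          ← Finset.mul_sum, hx']
        ring

theorem natDegree_and_coeff_prod_linear {σ : Type*} (s : Finset σ) (e₁ e₂ : σ → k) (m : σ → ℕ) :
    (∏ i ∈ s, (Polynomial.C (e₁ i) + Polynomial.X * Polynomial.C (e₂ i)) ^ m i).natDegree ≤
        ∑ i ∈ s, m i ∧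
      (∏ i ∈ s, (Polynomial.C (e₁ i) + Polynomial.X * Polynomial.C (e₂ i)) ^ m i).coeff
        (∑ i ∈ s, m i) = ∏ i ∈ s, e₂ i ^ m i := by
  classical
  induction s using Finset.induction_on with
  | empty => simp
  | insert i s hi ih =>
    have h1 : (Polynomial.C (e₁ i) + Polynomial.X * Polynomial.C (e₂ i)).natDegree ≤ 1 := by
      compute_degree
    have h2 : ((Polynomial.C (e₁ i) + Polynomial.X * Polynomial.C (e₂ i)) ^ m i).natDegree ≤ m i :=
      (Polynomial.natDegree_pow_le_of_le _ h1).trans_eq (mul_one _)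
    have h3 : ((Polynomial.C (e₁ i) + Polynomial.X * Polynomial.C (e₂ i)) ^ m i).coeff (m i) =
        e₂ i ^ m i := by
      have := Polynomial.coeff_pow_of_natDegree_le (m := m i) h1
      rw [mul_one] at this
      rw [this]
      simp [Polynomial.coeff_C]
    rw [Finset.prod_insert hi, Finset.prod_insert hi, Finset.sum_insert hi]
    exact ⟨Polynomial.natDegree_mul_le_of_le h2 ih.1, by
      rw [Polynomial.coeff_mul_add_eq_of_natDegree_le h2 ih.1, h3, ih.2]⟩

/-- The restriction of a form of degree `n` to the line through `e₁` and `e₂`: the value at `e₂` is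
the coefficient of `t ^ n`. -/
theorem natDegree_and_coeff_aeval_line {σ : Type*} {f : MvPolynomial σ k} {n : ℕ}
    (hf : f.IsHomogeneous n) (e₁ e₂ : σ → k) :
    (aeval (fun i => Polynomial.C (e₁ i) + Polynomial.X * Polynomial.C (e₂ i)) f).natDegree ≤ n ∧
      (aeval (fun i => Polynomial.C (e₁ i) + Polynomial.X * Polynomial.C (e₂ i)) f).coeff n =
        eval e₂ f := by
  have hd : ∀ m ∈ f.support, ∑ i ∈ m.support, m i = n := fun m hm => by
    by_contra h
    exact mem_support_iff.1 hm (hf.coeff_eq_zero h)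
  rw [aeval_def, eval₂_eq, eval_eq]
  refine ⟨Polynomial.natDegree_sum_le_of_forall_le _ _ fun m hm => ?_, ?_⟩
  · refine (Polynomial.natDegree_C_mul_le _ _).trans ?_
    rw [← hd m hm]
    exact (natDegree_and_coeff_prod_linear _ _ _ _).1
  · rw [Polynomial.finsetSum_coeff]
    refine Finset.sum_congr rfl fun m hm => ?_
    refine (Polynomial.coeff_C_mul _).trans ?_
    rw [← (natDegree_and_coeff_prod_linear m.support e₁ e₂ m).2, hd m hm]

/-- Over an infinite field, some linear combination of polynomials in one variable without common
zero is prime to a given `P`. -/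
theorem exists_isCoprime_combination [Infinite k] {ι : Type*} [Fintype ι] {f : ι → Polynomial k}
    {P : Polynomial k} (hP : P ≠ 0)
    (h : ∀ (D : Type u) [Field D] [Algebra k D] (t : D), ∃ j, Polynomial.aeval t (f j) ≠ 0) :
    ∃ v : ι → k, IsCoprime (∑ j, Polynomial.C (v j) * f j) P := by
  classical
  let V : Polynomial k → Subspace k (ι → k) := fun π =>
    ((Ideal.span {π}).restrictScalars k).comap (Fintype.linearCombination k f)
  have hV : ∀ π v, v ∈ V π ↔ π ∣ ∑ j, Polynomial.C (v j) * f j := fun π v => by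
    simp [V, Fintype.linearCombination_apply, Ideal.mem_span_singleton, Polynomial.smul_eq_C_mul]
  set Φ := (UniqueFactorizationMonoid.normalizedFactors P).toFinset with hΦ
  have htop : ⊤ ∉ Φ.image V := by
    intro hmem
    obtain ⟨π, hπ, hπV⟩ := Finset.mem_image.1 hmem
    have hirr := UniqueFactorizationMonoid.irreducible_of_normalized_factor π
      (Multiset.mem_toFinset.1 hπ)
    have : Fact (Irreducible π) := ⟨hirr⟩
    obtain ⟨j, hj⟩ := h (AdjoinRoot π) (AdjoinRoot.root π)
    refine hj ?_
    have h1 := (hV π (Pi.single j 1)).1 (hπV ▸ Submodule.mem_top)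
    rw [AdjoinRoot.aeval_eq, AdjoinRoot.mk_eq_zero]
    simpa [Pi.single_apply, apply_ite Polynomial.C, ite_mul] using h1
  obtain ⟨v, hv⟩ := (Set.ne_univ_iff_exists_notMem _).1
    (Subspace.biUnion_ne_univ_of_top_notMem htop)
  refine ⟨v, isCoprime_of_irreducible_dvd (fun h0 => hP h0.2) fun π hπ h1 h2 => hv ?_⟩
  obtain ⟨π', hπ', hass⟩ := UniqueFactorizationMonoid.exists_mem_normalizedFactors_of_dvd hP hπ h2
  exact Set.mem_biUnion (Finset.mem_coe.2 (Finset.mem_image_of_mem V (Multiset.mem_toFinset.2 hπ')))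
    ((hV π' v).2 (hass.symm.dvd.trans h1))

/-! ### The multidegree of the graph of a birational map -/

theorem ne_zero_of_eval_ne_zero {f : PlaneRing k} {n : ℕ} (hf : f.IsHomogeneous n)
    (hn : n ≠ 0) {x : Fin 3 → k} (hx : eval x f ≠ 0) : x ≠ 0 := by
  rintro rfl
  refine hx ?_
  have := aeval_mul_of_isHomogeneous hf (0 : k) 0
  rw [zero_pow hn, zero_mul] at this
  rw [← aeval_eq_eval, ← this]
  congr 2
  funext i
  simp

section Proportional

variable {S : Type*} [CommRing S] [Algebra k S]

/-- If `x` is the multiple by `s` of the rational vector `ξ`, then the minors of `(z, f(x))` are,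
up to the factor `s ^ n`, those of `(z, f(ξ))`. -/
theorem minor_aeval_mul {f : Fin 3 → PlaneRing k} {n : ℕ} (hf : ∀ j, (f j).IsHomogeneous n)
    {x z : Fin 3 → S} {ξ : Fin 3 → k} {s : S} (hx : ∀ i, x i = s * algebraMap k S (ξ i))
    (h : ∀ i j, z i * aeval x (f j) = z j * aeval x (f i)) (i j : Fin 3) :
    s ^ n * (z i * algebraMap k S (eval ξ (f j)) - z j * algebraMap k S (eval ξ (f i))) = 0 := by
  have h1 : ∀ l, aeval x (f l) = s ^ n * algebraMap k S (eval ξ (f l)) := fun l => by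
    rw [← aeval_algebraMap_comp, ← aeval_mul_of_isHomogeneous (hf l)]
    congr 2
    exact funext hx
  have h2 := h i j
  rw [h1, h1] at h2
  linear_combination h2

end Proportional

theorem graphIdeal_generalSectionLength_zero_two [Infinite k] {φ ψ : Fin 3 → PlaneRing k}
    {n e : ℕ} (hφn : ∀ j, (φ j).IsHomogeneous n) (hψe : ∀ j, (ψ j).IsHomogeneous e)
    {h g : PlaneRing k} (hh : h ≠ 0) (hhφ : ∀ j, bind₁ φ (ψ j) = h * X j)
    (hg : g ≠ 0) (hgψ : ∀ j, bind₁ ψ (φ j) = g * X j) :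
    GeneralSectionLength (graphIdeal φ) 0 2 1 := by
  have hψ0 : ψ 0 ≠ 0 := fun h0 => mul_ne_zero hh (X_ne_zero 0) (by rw [← hhφ 0, h0, map_zero])
  refine generalSectionLength_zero_two (mul_ne_zero (mul_ne_zero hg (X_ne_zero 0)) hψ0)
    fun b hb => ?_
  set η := crossProduct (b 0) (b 1) with hη
  rw [map_mul, map_mul, eval_X] at hb
  obtain ⟨⟨-, hη0⟩, hψη⟩ : (eval η g ≠ 0 ∧ η 0 ≠ 0) ∧ eval η (ψ 0) ≠ 0 := by
    simpa [not_or] using hb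
  set ξ : Fin 3 → k := fun i => eval η (ψ i) with hξ
  obtain ⟨u, hu⟩ := exists_dot_eq_one (ξ := ξ) fun h0 => hψη (congrFun h0 0)
  obtain ⟨v, hv⟩ := exists_dot_eq_one (ξ := η) fun h0 => hη0 (congrFun h0 0)
  -- The points of the section: `y` is proportional to `η`, and `x` to `Ψ(y)`.
  have hpt : ∀ (S : Type u) [CommRing S] [Algebra k S] (x y : Fin 3 → S),
      VanishesAt (graphIdeal φ ⊔ Ideal.span (Set.range fun s => yForm (b s))) x y →
      (∀ i, y i = (∑ j, algebraMap k S (v j) * y j) * algebraMap k S (η i)) ∧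
      ∀ i j, (∑ j, algebraMap k S (v j) * y j) ^ e *
        (x i * algebraMap k S (ξ j) - x j * algebraMap k S (ξ i)) = 0 := by
    intro S _ _ x y hxy
    rw [vanishesAt_sup_range] at hxy
    have hy := eq_mul_of_parallel hv (parallel_cross (by simpa using hxy.2 0)
      (by simpa using hxy.2 1))
    refine ⟨hy, minor_aeval_mul hψe hy fun i j => ?_⟩
    simpa [sub_eq_zero] using hxy.1 _ (inverse_minor_mem_graphIdeal hψe hhφ i j)
  refine hasLength_one (u := u) (v := v) (ξ := ξ) (η := η) (fun D _ _ x y hxy hux => ?_)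
    (fun D _ _ x y hxy hvy => ?_) ?_ hu hv fun S _ _ x y hxy hux hvy => ?_
  · obtain ⟨h1, h2⟩ := hpt D x y hxy
    by_cases hs : ∑ j, algebraMap k D (v j) * y j = 0
    · exact Or.inr (funext fun i => by rw [h1, hs, zero_mul, Pi.zero_apply])
    · left
      funext i
      rw [eq_mul_of_parallel hu (fun i j => sub_eq_zero.1
        ((mul_eq_zero.1 (h2 i j)).resolve_left (pow_ne_zero _ hs))) i, hux, zero_mul, Pi.zero_apply]
  · exact Or.inr (funext fun i => by rw [(hpt D x y hxy).1 i, hvy, zero_mul, Pi.zero_apply])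
  · rw [vanishesAt_sup_range]
    refine ⟨fun F hF => ?_, fun s => ?_⟩
    · have := aeval_inverse_eq_zero_of_mem_graphIdeal hφn hg hgψ hF η 1
      simpa only [one_mul, aeval_eq_eval] using this
    · rw [aeval_yForm, hη, Fin.sum_univ_three]
      fin_cases s <;> simp [cross_apply] <;> ring
  · obtain ⟨h1, h2⟩ := hpt S x y hxy
    rw [hvy] at h1 h2
    refine ⟨fun i => ?_, fun i => by rw [h1, one_mul]⟩
    rw [one_pow] at h2
    rw [eq_mul_of_parallel (x := x) hu (fun i j => by simpa [sub_eq_zero] using h2 i j) i, hux,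
      one_mul]

theorem graphIdeal_generalSectionLength_two_zero [Infinite k] {φ : Fin 3 → PlaneRing k}
    {n : ℕ} (hn : n ≠ 0) (hφn : ∀ j, (φ j).IsHomogeneous n) (hφ : φ ≠ 0) :
    GeneralSectionLength (graphIdeal φ) 2 0 1 := by
  obtain ⟨l, hl⟩ := Function.ne_iff.1 hφ
  refine generalSectionLength_two_zero hl fun a ha => ?_
  set ξ := crossProduct (a 0) (a 1) with hξ
  obtain ⟨u, hu⟩ := exists_dot_eq_one (ne_zero_of_eval_ne_zero (hφn l) hn ha)
  obtain ⟨v, hv⟩ := exists_dot_eq_one (ξ := value φ ξ) fun h0 => ha (congrFun h0 l)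
  have hpt : ∀ (S : Type u) [CommRing S] [Algebra k S] (x y : Fin 3 → S),
      VanishesAt (graphIdeal φ ⊔ Ideal.span (Set.range fun s => xForm (a s))) x y →
      (∀ i, x i = (∑ j, algebraMap k S (u j) * x j) * algebraMap k S (ξ i)) ∧
      ∀ i j, (∑ j, algebraMap k S (u j) * x j) ^ n *
        (y i * algebraMap k S (value φ ξ j) - y j * algebraMap k S (value φ ξ i)) = 0 := by
    intro S _ _ x y hxy
    rw [vanishesAt_sup_range] at hxy
    have hx := eq_mul_of_parallel hu (parallel_cross (by simpa using hxy.2 0)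
      (by simpa using hxy.2 1))
    refine ⟨hx, minor_aeval_mul hφn hx fun i j => ?_⟩
    simpa [sub_eq_zero] using hxy.1 _ (minor_mem_graphIdeal φ i j)
  refine hasLength_one (u := u) (v := v) (ξ := ξ) (η := value φ ξ) (fun D _ _ x y hxy hux => ?_)
    (fun D _ _ x y hxy hvy => ?_) ?_ hu hv fun S _ _ x y hxy hux hvy => ?_
  · exact Or.inl (funext fun i => by rw [(hpt D x y hxy).1 i, hux, zero_mul, Pi.zero_apply])
  · obtain ⟨h1, h2⟩ := hpt D x y hxy
    by_cases hs : ∑ j, algebraMap k D (u j) * x j = 0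
    · exact Or.inl (funext fun i => by rw [h1, hs, zero_mul, Pi.zero_apply])
    · right
      funext i
      rw [eq_mul_of_parallel hv (fun i j => sub_eq_zero.1
        ((mul_eq_zero.1 (h2 i j)).resolve_left (pow_ne_zero _ hs))) i, hvy, zero_mul, Pi.zero_apply]
  · rw [vanishesAt_sup_range]
    refine ⟨fun F hF => ?_, fun s => ?_⟩
    · have := aeval_eq_zero_of_mem_graphIdeal hφ hF ξ 1
      simp only [one_mul, aeval_eq_eval] at this
      exact this
    · rw [aeval_xForm, hξ, Fin.sum_univ_three]
      fin_cases s <;> simp [cross_apply] <;> ring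
  · obtain ⟨h1, h2⟩ := hpt S x y hxy
    rw [hux] at h1 h2
    refine ⟨fun i => by rw [h1, one_mul], fun i => ?_⟩
    rw [one_pow] at h2
    rw [eq_mul_of_parallel (x := y) hv (fun i j => by simpa [sub_eq_zero] using h2 i j) i, hvy,
      one_mul]

/-- Over a general line `ℓ` the graph is isomorphic to `ℓ`, and the section by a general form
`b₀ y₀ + b₁ y₁ + b₂ y₂` is cut out on `ℓ` by the form `b₀ φ₀ + b₁ φ₁ + b₂ φ₂` of degree `n`. -/
theorem graphIdeal_generalSectionLength_one_one [Infinite k] {φ : Fin 3 → PlaneRing k}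
    {n : ℕ} (hn : n ≠ 0) (hφn : ∀ j, (φ j).IsHomogeneous n)
    (hφ2 : 2 ≤ (baseIdeal φ).height) :
    GeneralSectionLength (graphIdeal φ) 1 1 n := by
  have hφ := ne_zero_of_two_le_height hφ2
  obtain ⟨l, hl⟩ := Function.ne_iff.1 hφ
  obtain ⟨G, hG, hGline⟩ := exists_general_line hφn hφ2
  obtain ⟨a₁, z, hz, ha₁⟩ := exists_cross_eval_ne_zero hl
  obtain ⟨a₂, ha₂⟩ : ∃ ξ, eval ξ G ≠ 0 := by
    by_contra! h0
    exact hG (MvPolynomial.funext fun ξ => by rw [h0 ξ, map_zero])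
  -- Besides avoiding the base locus, the line has a rational point, namely `a ⨯ z`, at which
  -- `b₀ φ₀ + b₁ φ₁ + b₂ φ₂` does not vanish.
  let F₁ : MvPolynomial ((Fin 1 × Fin 3) ⊕ (Fin 1 × Fin 3)) k :=
    aeval (fun i => X (Sum.inl (0, i))) G
  let F₂ : MvPolynomial ((Fin 1 × Fin 3) ⊕ (Fin 1 × Fin 3)) k :=
    ∑ j, X (Sum.inr (0, j)) *
      aeval (crossProduct (fun i => X (Sum.inl (0, i))) fun i => C (z i)) (φ j)
  have hF₁ : ∀ a b : Fin 1 → Fin 3 → k,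
      eval (Sum.elim (fun s => a s.1 s.2) fun s => b s.1 s.2) F₁ = eval (a 0) G := by
    intro a b
    rw [← aeval_eq_eval, ← AlgHom.comp_apply, ← aeval_eq_eval]
    congr 1
    exact algHom_ext fun i => by simp
  have hF₂ : ∀ a b : Fin 1 → Fin 3 → k,
      eval (Sum.elim (fun s => a s.1 s.2) fun s => b s.1 s.2) F₂ =
        ∑ j, b 0 j * eval (crossProduct (a 0) z) (φ j) := by
    intro a b
    rw [map_sum]
    refine Finset.sum_congr rfl fun j _ => ?_
    rw [map_mul, eval_X, Sum.elim_inr]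
    congr 1
    rw [← aeval_eq_eval, ← AlgHom.comp_apply, ← aeval_eq_eval]
    congr 1
    refine algHom_ext fun i => ?_
    fin_cases i <;> simp [cross_apply]
  refine ⟨F₁ * F₂, mul_ne_zero (fun h0 => ha₂ ?_) (fun h0 => ha₁ ?_), fun a b hab => ?_⟩
  · rw [← hF₁ (fun _ => a₂) (fun _ => 0), h0, map_zero]
  · have := hF₂ (fun _ => a₁) fun _ => Pi.single l 1
    rw [h0, map_zero] at this
    simpa [Pi.single_apply] using this.symm
  rw [map_mul, hF₁, hF₂] at hab
  obtain ⟨hGa, hP⟩ := mul_ne_zero_iff.1 hab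
  set e₂ := crossProduct (a 0) z with he₂
  have hφe₂ : ∃ j, eval e₂ (φ j) ≠ 0 := by
    by_contra! h0
    exact hP (Finset.sum_eq_zero fun j _ => by rw [h0, mul_zero])
  obtain ⟨l', hl'⟩ := hφe₂
  have he₂0 : e₂ ≠ 0 := ne_zero_of_eval_ne_zero (hφn l') hn hl'
  have ha0 : a 0 ≠ 0 := fun h0 => he₂0 (by rw [he₂, h0, map_zero, LinearMap.zero_apply])
  obtain ⟨e₁, u, w, hae₁, hue₁, hue₂, hwe₁, hwe₂, hline⟩ := exists_line_coordinates ha0 he₂0 (by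
    rw [he₂, Fin.sum_univ_three]
    simp [cross_apply]
    ring)
  have hae₂ : ∑ i, a 0 i * e₂ i = 0 := by
    rw [he₂, Fin.sum_univ_three]
    simp [cross_apply]
    ring
  let xs : Fin 3 → Polynomial k := fun i => Polynomial.C (e₁ i) + Polynomial.X * Polynomial.C (e₂ i)
  let f : Fin 3 → Polynomial k := fun j => aeval xs (φ j)
  have hxs : ∀ {S : Type u} [CommRing S] [Algebra k S] (t : S) (i),
      Polynomial.aeval t (xs i) = algebraMap k S (e₁ i) + t * algebraMap k S (e₂ i) :=
    fun t i => by simp only [xs, map_add, map_mul, Polynomial.aeval_C, Polynomial.aeval_X]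
  have hf : ∀ {S : Type u} [CommRing S] [Algebra k S] (t : S) (j), Polynomial.aeval t (f j) =
      aeval (fun i => algebraMap k S (e₁ i) + t * algebraMap k S (e₂ i)) (φ j) := by
    intro S _ _ t j
    rw [← AlgHom.comp_apply]
    congr 1
    refine algHom_ext fun i => ?_
    rw [AlgHom.comp_apply, aeval_X, aeval_X, hxs]
  have hsum : ∀ {S : Type u} [CommRing S] [Algebra k S] (c : Fin 3 → k) (s t : S),
      ∑ i, algebraMap k S (c i) * (s * algebraMap k S (e₁ i) + t * algebraMap k S (e₂ i)) =
        s * algebraMap k S (∑ i, c i * e₁ i) + t * algebraMap k S (∑ i, c i * e₂ i) := by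
    intro S _ _ c s t
    simp only [map_sum, map_mul, Finset.mul_sum, ← Finset.sum_add_distrib]
    exact Finset.sum_congr rfl fun i _ => by ring
  let P : Polynomial k := ∑ j, Polynomial.C (b 0 j) * f j
  have hPcoeff : P.coeff n ≠ 0 := by
    rw [Polynomial.finsetSum_coeff]
    have h1 : ∀ j, (f j).coeff n = eval e₂ (φ j) := fun j =>
      (natDegree_and_coeff_aeval_line (hφn j) e₁ e₂).2
    simpa only [Polynomial.coeff_C_mul, h1] using hP
  have hPdeg : P.natDegree = n :=
    Polynomial.natDegree_eq_of_le_of_coeff_ne_zero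
      (Polynomial.natDegree_sum_le_of_forall_le _ _ fun j _ =>
        (Polynomial.natDegree_C_mul_le _ _).trans
          (natDegree_and_coeff_aeval_line (hφn j) e₁ e₂).1) hPcoeff
  have hP0 : P ≠ 0 := fun h0 => hPcoeff (by rw [h0, Polynomial.coeff_zero])
  obtain ⟨v, hv⟩ := exists_isCoprime_combination (f := f) hP0 fun D _ _ t => by
    by_contra! h0
    have h1 := hGline _ hGa D (fun i => algebraMap k D (e₁ i) + t * algebraMap k D (e₂ i))
      (fun j => by rw [← hf, h0]) (by
        have := hsum (a 0) (1 : D) t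
        rw [hae₁, hae₂] at this
        simpa using this)
    have h2 := hsum u (1 : D) t
    rw [hue₁, hue₂] at h2
    simp only [one_mul, map_one, map_zero, mul_zero, add_zero] at h2
    refine one_ne_zero (α := D) (h2.symm.trans (Finset.sum_eq_zero fun i _ => ?_))
    rw [congrFun h1 i, Pi.zero_apply, mul_zero]
  obtain ⟨c, d, hcd⟩ := hv
  have hmk : ∀ j, aeval (fun i => AdjoinRoot.mk P (xs i)) (φ j) = AdjoinRoot.mk P (f j) := by
    intro j
    have : (aeval fun i => AdjoinRoot.mk P (xs i)) = (AdjoinRoot.mkₐ P).comp (aeval xs) :=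
      algHom_ext fun i => by simp
    rw [this]
    rfl
  have hmkC : ∀ r : k, algebraMap k (AdjoinRoot P) r = AdjoinRoot.mk P (Polynomial.C r) :=
    fun r => rfl
  have hmkx : ∀ r : Fin 3 → k, ∑ i, algebraMap k (AdjoinRoot P) (r i) * AdjoinRoot.mk P (xs i) =
      algebraMap k _ (∑ i, r i * e₁ i) + AdjoinRoot.root P * algebraMap k _ (∑ i, r i * e₂ i) := by
    intro r
    have := hsum r (1 : AdjoinRoot P) (AdjoinRoot.root P)
    simp only [one_mul] at this
    rw [← this]
    refine Finset.sum_congr rfl fun i _ => ?_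
    rw [← hxs, AdjoinRoot.aeval_eq]
  -- The equations satisfied by the points of the section.
  have hpt : ∀ {S : Type u} [CommRing S] [Algebra k S] {x y : Fin 3 → S},
      VanishesAt (graphIdeal φ ⊔ Ideal.span (Set.range fun s => xForm (a s)) ⊔
        Ideal.span (Set.range fun s => yForm (b s))) x y →
      ∑ i, algebraMap k S (a 0 i) * x i = 0 ∧ ∑ i, algebraMap k S (b 0 i) * y i = 0 ∧
      (∀ i j, y i * aeval x (φ j) = y j * aeval x (φ i)) ∧
      (∀ c : Fin 3 → k, ∀ j, y j * ∑ i, algebraMap k S (c i) * aeval x (φ i) =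
        (∑ i, algebraMap k S (c i) * y i) * aeval x (φ j)) := by
    intro S _ _ x y hxy
    rw [vanishesAt_sup_range, vanishesAt_sup_range] at hxy
    have hmin : ∀ i j, y i * aeval x (φ j) = y j * aeval x (φ i) := fun i j => by
      simpa [sub_eq_zero] using hxy.1.1 _ (minor_mem_graphIdeal φ i j)
    refine ⟨by simpa using hxy.1.2 0, by simpa using hxy.2 0, hmin, fun c j => ?_⟩
    rw [Finset.mul_sum, Finset.sum_mul]
    exact Finset.sum_congr rfl fun i _ => by linear_combination algebraMap k S (c i) * hmin j i
  have haevalP : ∀ {S : Type u} [CommRing S] [Algebra k S] (t : S) (c : Fin 3 → k),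
      Polynomial.aeval t (∑ j, Polynomial.C (c j) * f j) =
        ∑ j, algebraMap k S (c j) * Polynomial.aeval t (f j) := by
    intro S _ _ t c
    simp only [map_sum, map_mul, Polynomial.aeval_C]
  rw [← hPdeg]
  refine hasLength_natDegree (u := u) (v := v) hP0 xs (fun j => c * f j) (xForm w)
    (fun D _ _ x y hxy hux => ?_) (fun D _ _ x y hxy hvy => ?_) ?_ ?_ ?_ ?_
    fun S _ _ x y hxy hux hvy => ?_
  · -- On `{u = 0}`, the point `x` is a multiple of `e₂`, where `b₀ φ₀ + b₁ φ₁ + b₂ φ₂ ≠ 0`.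
    obtain ⟨hax, hby, hmin, -⟩ := hpt hxy
    have hx : ∀ i, x i = (∑ j, algebraMap k D (w j) * x j) * algebraMap k D (e₂ i) := fun i => by
      conv_lhs => rw [hline x hax i, hux, zero_mul, zero_add]
    by_cases hs : ∑ j, algebraMap k D (w j) * x j = 0
    · exact Or.inl (funext fun i => by rw [hx, hs, zero_mul, Pi.zero_apply])
    right
    have h1 : ∀ i j, y i * algebraMap k D (eval e₂ (φ j)) = y j * algebraMap k D (eval e₂ (φ i)) :=
      fun i j => sub_eq_zero.1 ((mul_eq_zero.1 (minor_aeval_mul hφn hx hmin i j)).resolve_left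
        (pow_ne_zero _ hs))
    funext j
    have h2 : y j * algebraMap k D (∑ i, b 0 i * eval e₂ (φ i)) = 0 := by
      have h3 : (∑ i, algebraMap k D (b 0 i) * y i) * algebraMap k D (eval e₂ (φ j)) = 0 := by
        rw [hby, zero_mul]
      rw [← h3, map_sum, Finset.mul_sum, Finset.sum_mul]
      exact Finset.sum_congr rfl fun i _ => by
        rw [map_mul]
        linear_combination algebraMap k D (b 0 i) * h1 j i
    exact (mul_eq_zero.1 h2).resolve_right ((map_ne_zero (algebraMap k D)).2 hP)
  · -- On `{v = 0}`, the forms `∑ bⱼ φⱼ` and `∑ vⱼ φⱼ`, which are coprime on `ℓ`, vanish at `x`.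
    obtain ⟨hax, hby, hmin, hcomb⟩ := hpt hxy
    by_cases hy : y = 0
    · exact Or.inr hy
    left
    obtain ⟨j, hj⟩ := Function.ne_iff.1 hy
    have hb0 := (mul_eq_zero.1 ((hcomb (b 0) j).trans (by rw [hby, zero_mul]))).resolve_left hj
    have hv0 := (mul_eq_zero.1 ((hcomb v j).trans (by rw [hvy, zero_mul]))).resolve_left hj
    set s := ∑ j, algebraMap k D (u j) * x j with hs
    set t := ∑ j, algebraMap k D (w j) * x j with ht
    by_cases hs0 : s = 0
    · have hx : ∀ i, x i = t * algebraMap k D (e₂ i) := fun i => by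
        rw [hline x hax i, ← hs, ← ht, hs0, zero_mul, zero_add]
      have h1 : ∀ i, aeval x (φ i) = t ^ n * algebraMap k D (eval e₂ (φ i)) := fun i => by
        rw [← aeval_algebraMap_comp, ← aeval_mul_of_isHomogeneous (hφn i)]
        congr 2
        exact funext hx
      have h2 : t ^ n * algebraMap k D (∑ i, b 0 i * eval e₂ (φ i)) = 0 := by
        rw [← hb0, map_sum, Finset.mul_sum]
        exact Finset.sum_congr rfl fun i _ => by rw [h1, map_mul]; ring
      have h3 : t = 0 := by
        exact eq_zero_of_pow_eq_zero
          ((mul_eq_zero.1 h2).resolve_right ((map_ne_zero (algebraMap k D)).2 hP))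
      exact funext fun i => by rw [hx, h3, zero_mul, Pi.zero_apply]
    · exfalso
      have h1 : ∀ i, aeval x (φ i) = s ^ n * Polynomial.aeval (t / s) (f i) := fun i => by
        rw [hf, ← aeval_mul_of_isHomogeneous (hφn i)]
        congr 2
        funext i
        rw [hline x hax i, ← hs, ← ht]
        field_simp
      have h2 : ∀ c : Fin 3 → k, ∑ i, algebraMap k D (c i) * aeval x (φ i) = 0 →
          Polynomial.aeval (t / s) (∑ j, Polynomial.C (c j) * f j) = 0 := by
        intro c hc
        rw [haevalP]
        refine (mul_eq_zero.1 ?_).resolve_left (pow_ne_zero n hs0)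
        rw [← hc, Finset.mul_sum]
        exact Finset.sum_congr rfl fun i _ => by rw [h1]; ring
      have h3 := congrArg (Polynomial.aeval (t / s)) hcd
      rw [map_add, map_mul, map_mul, h2 v hv0, h2 (b 0) hb0, mul_zero, mul_zero, add_zero,
        map_one] at h3
      exact zero_ne_one h3
  · rw [vanishesAt_sup_range, vanishesAt_sup_range]
    refine ⟨⟨fun F hF => ?_, fun s => ?_⟩, fun s => ?_⟩
    · have := aeval_eq_zero_of_mem_graphIdeal hφ hF (fun i => AdjoinRoot.mk P (xs i))
        (AdjoinRoot.mk P c)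
      simpa only [hmk, ← map_mul] using this
    · rw [aeval_xForm, Subsingleton.elim s 0, hmkx, hae₁, hae₂, map_zero, mul_zero, add_zero]
    · rw [aeval_yForm, Subsingleton.elim s 0]
      simp only [hmkC, ← map_mul, ← map_sum]
      rw [AdjoinRoot.mk_eq_zero]
      refine ⟨c, ?_⟩
      rw [Finset.sum_mul]
      exact Finset.sum_congr rfl fun i _ => by ring
  · rw [hmkx, hue₁, hue₂, map_zero, mul_zero, add_zero, map_one]
  · simp only [hmkC, ← map_mul, ← map_sum]
    rw [← map_one (AdjoinRoot.mk P), AdjoinRoot.mk_eq_mk]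
    refine ⟨-d, ?_⟩
    have h1 : ∑ i, Polynomial.C (v i) * (c * f i) = c * ∑ i, Polynomial.C (v i) * f i := by
      rw [Finset.mul_sum]
      exact Finset.sum_congr rfl fun i _ => by ring
    rw [h1]
    linear_combination hcd
  · rw [aeval_xForm, hmkx, hwe₁, hwe₂, map_zero, zero_add, map_one, mul_one]
  · obtain ⟨hax, hby, hmin, hcomb⟩ := hpt hxy
    rw [aeval_xForm]
    set t := ∑ j, algebraMap k S (w j) * x j with ht
    have hx : ∀ i, Polynomial.aeval t (xs i) = x i := fun i => by
      rw [hxs, hline x hax i, hux, one_mul]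
    have hfx : ∀ i, Polynomial.aeval t (f i) = aeval x (φ i) := fun i => by
      rw [hf]
      congr 2
      exact funext fun i => by rw [← hxs, hx]
    have hy : ∀ j, y j * Polynomial.aeval t (∑ i, Polynomial.C (v i) * f i) =
        Polynomial.aeval t (f j) := fun j => by
      rw [haevalP, hfx]
      simp only [hfx]
      rw [hcomb, hvy, one_mul]
    have hPt : Polynomial.aeval t P = 0 := by
      change Polynomial.aeval t (∑ j, Polynomial.C (b 0 j) * f j) = 0
      rw [haevalP]
      have h1 : ∑ j, algebraMap k S (b 0 j) * Polynomial.aeval t (f j) =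
          (∑ j, algebraMap k S (b 0 j) * y j) *
            Polynomial.aeval t (∑ i, Polynomial.C (v i) * f i) := by
        rw [Finset.sum_mul]
        exact Finset.sum_congr rfl fun j _ => by rw [← hy j]; ring
      rw [h1, hby, zero_mul]
    refine ⟨hPt, hx, fun j => ?_⟩
    have h1 := congrArg (Polynomial.aeval t) hcd
    rw [map_add, map_mul, map_mul, hPt, mul_zero, add_zero, map_one] at h1
    rw [map_mul, ← hy]
    linear_combination y j * h1

theorem graphIdeal_hasMultidegree [Infinite k] {φ ψ : Fin 3 → PlaneRing k}
    {n e : ℕ} (hn : n ≠ 0) (hφn : ∀ j, (φ j).IsHomogeneous n)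
    (hφ2 : 2 ≤ (baseIdeal φ).height) (hψe : ∀ j, (ψ j).IsHomogeneous e)
    {h g : PlaneRing k} (hh : h ≠ 0) (hhφ : ∀ j, bind₁ φ (ψ j) = h * X j)
    (hg : g ≠ 0) (hgψ : ∀ j, bind₁ ψ (φ j) = g * X j) :
    HasMultidegree (graphIdeal φ) ![1, n, 1] := by
  intro i
  fin_cases i
  · exact graphIdeal_generalSectionLength_zero_two hφn hψe hh hhφ hg hgψ
  · exact graphIdeal_generalSectionLength_one_one hn hφn hφ2
  · exact graphIdeal_generalSectionLength_two_zero hn hφn (ne_zero_of_two_le_height hφ2)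

/-! ### The torsion component over general lines and points of the source -/

theorem torsionIdeal_generalSectionLength_two_zero [Infinite k] {φ : Fin 3 → PlaneRing k}
    {n : ℕ} (hφn : ∀ j, (φ j).IsHomogeneous n) (hφ : φ ≠ 0) :
    GeneralSectionLength (torsionIdeal φ) 2 0 0 := by
  obtain ⟨l, hl⟩ := Function.ne_iff.1 hφ
  refine generalSectionLength_two_zero (mul_ne_zero hl (X_ne_zero 0)) fun a ha => ?_
  set ξ := crossProduct (a 0) (a 1) with hξ
  rw [map_mul, eval_X] at ha
  obtain ⟨hξl, hξ0⟩ := mul_ne_zero_iff.1 ha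
  obtain ⟨u, hu⟩ := exists_dot_eq_one (ξ := ξ) fun h0 => hξ0 (congrFun h0 0)
  obtain ⟨e, he⟩ := exists_pow_mem_torsionIdeal hφ l
  refine hasLength_zero (isEmptyScheme_of_forall_field fun D _ _ x y hxy => Or.inl ?_)
  rw [vanishesAt_sup_range] at hxy
  have hx := eq_mul_of_parallel hu (parallel_cross (by simpa using hxy.2 0)
    (by simpa using hxy.2 1))
  have h1 := hxy.1 _ he
  rw [map_pow, aeval_rename_inl, funext hx, aeval_mul_of_isHomogeneous (hφn l),
    aeval_algebraMap_comp] at h1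
  have h2 := (mul_eq_zero.1 (eq_zero_of_pow_eq_zero h1)).resolve_right
    ((map_ne_zero (algebraMap k D)).2 hξl)
  have h3 := eq_zero_of_pow_eq_zero h2
  exact funext fun i => by rw [hx, h3, zero_mul, Pi.zero_apply]

theorem torsionIdeal_generalSectionLength_one_one [Infinite k] {φ : Fin 3 → PlaneRing k}
    {n : ℕ} (hφn : ∀ j, (φ j).IsHomogeneous n) (hφ2 : 2 ≤ (baseIdeal φ).height) :
    GeneralSectionLength (torsionIdeal φ) 1 1 0 := by
  have hφ := ne_zero_of_two_le_height hφ2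
  obtain ⟨G, hG, hGline⟩ := exists_general_line hφn hφ2
  refine ⟨rename (fun i => Sum.inl (0, i)) G, fun h0 => hG ?_, fun a b hab => ?_⟩
  · exact rename_injective _ (fun i j hij => by simpa using hij) (h0.trans (map_zero _).symm)
  rw [eval_rename] at hab
  refine hasLength_zero (isEmptyScheme_of_forall_field fun D _ _ x y hxy => Or.inl ?_)
  rw [vanishesAt_sup_range, vanishesAt_sup_range] at hxy
  refine hGline (a 0) hab D x (fun j => ?_) (by simpa using hxy.1.2 0)
  obtain ⟨e, he⟩ := exists_pow_mem_torsionIdeal hφ j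
  have h1 := hxy.1.1 _ he
  rw [map_pow, aeval_rename_inl] at h1
  exact eq_zero_of_pow_eq_zero h1

/-! ### De Jonquières maps -/

section Forms

variable {S T : Type*} [CommRing S] [Algebra k S] [CommRing T] [Algebra k T]

/-- The linear form `c₀ y₀ + c₁ y₁ + c₂ y₂`, evaluated in a `k`-algebra. -/
noncomputable def linForm (c : Fin 3 → k) (y : Fin 3 → S) : S := ∑ j, algebraMap k S (c j) * y j

/-- The form `∑ⱼ qⱼ(s, t) yⱼ`, linear in `y`, attached to three binary forms `qⱼ`. -/
noncomputable def binForm (q : Fin 3 → MvPolynomial (Fin 2) k) (s t : S) (y : Fin 3 → S) : S :=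
  ∑ j, aeval ![s, t] (q j) * y j

theorem map_linForm (f : S →ₐ[k] T) (c : Fin 3 → k) (y : Fin 3 → S) :
    f (linForm c y) = linForm c fun i => f (y i) := by
  simp [linForm]

theorem map_binForm (f : S →ₐ[k] T) (q : Fin 3 → MvPolynomial (Fin 2) k) (s t : S)
    (y : Fin 3 → S) : f (binForm q s t y) = binForm q (f s) (f t) fun i => f (y i) := by
  have h : f.comp (aeval ![s, t]) = aeval ![f s, f t] :=
    algHom_ext fun i => by fin_cases i <;> simp
  simp only [binForm, map_sum, map_mul, ← h, AlgHom.comp_apply]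

theorem binForm_mul {q : Fin 3 → MvPolynomial (Fin 2) k} {d : ℕ}
    (hq : ∀ j, (q j).IsHomogeneous d) (c s t : S) (y : Fin 3 → S) :
    binForm q (c * s) (c * t) y = c ^ d * binForm q s t y := by
  rw [binForm, binForm, Finset.mul_sum]
  refine Finset.sum_congr rfl fun j _ => ?_
  rw [← mul_assoc, ← aeval_mul_of_isHomogeneous (hq j)]
  congr 3
  funext i
  fin_cases i <;> rfl

end Forms

/-- The data of a `3 × 2` matrix whose second column consists of forms of degree `m + 1`: the first
column has the entries `aⱼ x₀ + bⱼ x₁`, the second one the entries `x₂ qⱼ + rⱼ` with binary forms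
`qⱼ` and `rⱼ` in `x₀`, `x₁` of degrees `m` and `m + 1`. -/
structure JonquieresData (k : Type u) [Field k] (m : ℕ) where
  a : Fin 3 → k
  b : Fin 3 → k
  q : Fin 3 → MvPolynomial (Fin 2) k
  r : Fin 3 → MvPolynomial (Fin 2) k
  hq : ∀ j, (q j).IsHomogeneous m
  hr : ∀ j, (r j).IsHomogeneous (m + 1)

namespace JonquieresData

variable {m : ℕ} (D : JonquieresData k m)

/-- The first column of the matrix. -/
noncomputable def col₀ : Fin 3 → PlaneRing k := fun j => C (D.a j) * X 0 + C (D.b j) * X 1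

/-- The second column of the matrix. -/
noncomputable def col₁ : Fin 3 → PlaneRing k := fun j =>
  X 2 * aeval ![X 0, X 1] (D.q j) + aeval ![X 0, X 1] (D.r j)

/-- The signed `2`-minors of the matrix. -/
noncomputable def map : Fin 3 → PlaneRing k := crossProduct D.col₀ D.col₁

section Evaluation

variable {S : Type*} [CommRing S] [Algebra k S]

/-- The form `∑ⱼ qⱼ(b · y, - a · y) yⱼ`: on the graph `(x₀ : x₁) = (b · y : - a · y)`. -/
noncomputable def qForm (y : Fin 3 → S) : S := binForm D.q (linForm D.b y) (-linForm D.a y) y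

/-- The form `∑ⱼ rⱼ(b · y, - a · y) yⱼ`. -/
noncomputable def rForm (y : Fin 3 → S) : S := binForm D.r (linForm D.b y) (-linForm D.a y) y

/-- The inverse map: on the graph `(x₀ : x₁) = (b · y : - a · y)`, and the equation given by the
second column can be solved for `x₂`. -/
noncomputable def inverse : Fin 3 → PlaneRing k :=
  ![linForm D.b X * D.qForm X, -linForm D.a X * D.qForm X, -D.rForm X]

theorem aeval_qForm (y : Fin 3 → S) : aeval y (D.qForm (X : Fin 3 → PlaneRing k)) = D.qForm y := by
  simp only [qForm, map_binForm, map_neg, map_linForm, aeval_X]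

theorem aeval_rForm (y : Fin 3 → S) : aeval y (D.rForm (X : Fin 3 → PlaneRing k)) = D.rForm y := by
  simp only [rForm, map_binForm, map_neg, map_linForm, aeval_X]

theorem aeval_inverse_zero (y : Fin 3 → S) :
    aeval y (D.inverse 0) = linForm D.b y * D.qForm y := by
  simp only [inverse, Matrix.cons_val_zero, map_mul, map_linForm, aeval_X, aeval_qForm]

theorem aeval_inverse_one (y : Fin 3 → S) :
    aeval y (D.inverse 1) = -linForm D.a y * D.qForm y := by
  simp only [inverse, Matrix.cons_val_one, Matrix.cons_val_zero, map_mul, map_neg, map_linForm,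
    aeval_X, aeval_qForm]

theorem aeval_inverse_two (y : Fin 3 → S) : aeval y (D.inverse 2) = -D.rForm y := by
  simp only [inverse, Matrix.cons_val, map_neg, aeval_rForm]

theorem aeval_col₀ (x : Fin 3 → S) (j : Fin 3) : aeval x (D.col₀ j) =
    algebraMap k S (D.a j) * x 0 + algebraMap k S (D.b j) * x 1 := by
  simp [col₀]

theorem aeval_col₁ (x : Fin 3 → S) (j : Fin 3) : aeval x (D.col₁ j) =
    x 2 * aeval ![x 0, x 1] (D.q j) + aeval ![x 0, x 1] (D.r j) := by
  have h : (aeval x : PlaneRing k →ₐ[k] S).comp (aeval ![X 0, X 1]) = aeval ![x 0, x 1] :=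
    algHom_ext fun i => by fin_cases i <;> simp
  simp only [col₁, map_add, map_mul, aeval_X, ← h, AlgHom.comp_apply]

theorem sum_aeval_col₀_mul (x y : Fin 3 → S) : ∑ j, aeval x (D.col₀ j) * y j =
    x 0 * linForm D.a y + x 1 * linForm D.b y := by
  simp only [aeval_col₀, linForm, Finset.mul_sum, ← Finset.sum_add_distrib]
  exact Finset.sum_congr rfl fun j _ => by ring

theorem sum_aeval_col₁_mul (x y : Fin 3 → S) : ∑ j, aeval x (D.col₁ j) * y j =
    x 2 * binForm D.q (x 0) (x 1) y + binForm D.r (x 0) (x 1) y := by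
  simp only [aeval_col₁, binForm, Finset.mul_sum, ← Finset.sum_add_distrib]
  exact Finset.sum_congr rfl fun j _ => by ring

theorem aeval_map (x : Fin 3 → S) (j : Fin 3) : aeval x (D.map j) =
    crossProduct (fun i => aeval x (D.col₀ i)) (fun i => aeval x (D.col₁ i)) j := by
  fin_cases j <;> simp [map, cross_apply]

theorem qForm_eq {y : Fin 3 → S} {c s t : S} (hb : linForm D.b y = c * s)
    (ha : -linForm D.a y = c * t) : D.qForm y = c ^ m * binForm D.q s t y := by
  rw [qForm, hb, ha, binForm_mul D.hq]

theorem rForm_eq {y : Fin 3 → S} {c s t : S} (hb : linForm D.b y = c * s)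
    (ha : -linForm D.a y = c * t) : D.rForm y = c ^ (m + 1) * binForm D.r s t y := by
  rw [rForm, hb, ha, binForm_mul D.hr]

theorem linForm_b_cross (x z : Fin 3 → S) :
    linForm D.b (crossProduct (fun i => aeval x (D.col₀ i)) z) =
      linForm (crossProduct D.b D.a) z * x 0 := by
  simp [linForm, Fin.sum_univ_three, aeval_col₀, cross_apply]
  ring

theorem linForm_a_cross (x z : Fin 3 → S) :
    -linForm D.a (crossProduct (fun i => aeval x (D.col₀ i)) z) =
      linForm (crossProduct D.b D.a) z * x 1 := by
  simp [linForm, Fin.sum_univ_three, aeval_col₀, cross_apply]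
  ring

end Evaluation

theorem map_isHomogeneous (j : Fin 3) : (D.map j).IsHomogeneous (m + 2) := by
  have h0 : ∀ j, (D.col₀ j).IsHomogeneous 1 := fun j =>
    (isHomogeneous_C_mul_X _ _).add (isHomogeneous_C_mul_X _ _)
  have hX : ∀ i : Fin 2, (![X 0, X 1] i : PlaneRing k).IsHomogeneous 1 := fun i => by
    fin_cases i <;> exact isHomogeneous_X _ _
  have h1 : ∀ j, (D.col₁ j).IsHomogeneous (m + 1) := fun j => by
    refine IsHomogeneous.add ?_ ?_
    · have := (isHomogeneous_X k (2 : Fin 3)).mul ((D.hq j).aeval _ hX)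
      rwa [one_mul, add_comm] at this
    · simpa using (D.hr j).aeval _ hX
  have h2 : ∀ i j, (D.col₀ i * D.col₁ j).IsHomogeneous (m + 2) := fun i j => by
    have := (h0 i).mul (h1 j)
    rwa [show 1 + (m + 1) = m + 2 by ring] at this
  rw [map]
  fin_cases j <;> simp only [cross_apply] <;> exact (h2 _ _).sub (h2 _ _)

theorem linForm_isHomogeneous (c : Fin 3 → k) :
    (linForm c X : PlaneRing k).IsHomogeneous 1 :=
  IsHomogeneous.sum _ _ _ fun _ _ => isHomogeneous_C_mul_X _ _

theorem binForm_isHomogeneous {q : Fin 3 → MvPolynomial (Fin 2) k} {d : ℕ}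
    (hq : ∀ j, (q j).IsHomogeneous d) :
    (binForm q (linForm D.b X) (-linForm D.a X) X : PlaneRing k).IsHomogeneous (d + 1) := by
  refine IsHomogeneous.sum _ _ _ fun j _ => IsHomogeneous.mul ?_ (isHomogeneous_X _ _)
  have := (hq j).aeval (![linForm D.b X, -linForm D.a X] : Fin 2 → PlaneRing k) (n := 1)
    fun i => by
      fin_cases i
      · exact linForm_isHomogeneous _
      · exact (linForm_isHomogeneous _).neg
  rwa [one_mul] at this

theorem qForm_isHomogeneous : (D.qForm X : PlaneRing k).IsHomogeneous (m + 1) :=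
  D.binForm_isHomogeneous D.hq

theorem rForm_isHomogeneous : (D.rForm X : PlaneRing k).IsHomogeneous (m + 2) :=
  D.binForm_isHomogeneous D.hr

theorem inverse_isHomogeneous (j : Fin 3) : (D.inverse j).IsHomogeneous (m + 2) := by
  have h : 1 + (m + 1) = m + 2 := by ring
  fin_cases j
  · exact h ▸ (linForm_isHomogeneous D.b).mul D.qForm_isHomogeneous
  · exact h ▸ (linForm_isHomogeneous D.a).neg.mul D.qForm_isHomogeneous
  · exact D.rForm_isHomogeneous.neg

/-- The common factor of `b · Φ = c x₀` and `- a · Φ = c x₁`. -/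
noncomputable def factor : PlaneRing k := linForm (crossProduct D.b D.a) D.col₁

theorem col_X : (fun i => aeval X (D.col₀ i) : Fin 3 → PlaneRing k) = D.col₀ :=
  funext fun _ => aeval_X_left_apply _

theorem linForm_b_map : linForm D.b D.map = D.factor * X 0 := by
  have := D.linForm_b_cross (X : Fin 3 → PlaneRing k) D.col₁
  rwa [col_X] at this

theorem linForm_a_map : -linForm D.a D.map = D.factor * X 1 := by
  have := D.linForm_a_cross (X : Fin 3 → PlaneRing k) D.col₁
  rwa [col_X] at this

theorem sum_col₀_mul_map : ∑ j, D.col₀ j * D.map j = 0 := by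
  simp [map, Fin.sum_univ_three, cross_apply]
  ring

theorem sum_col₁_mul_map : ∑ j, D.col₁ j * D.map j = 0 := by
  simp [map, Fin.sum_univ_three, cross_apply]
  ring

theorem X_two_mul_binForm_map :
    X 2 * binForm D.q (X 0) (X 1) D.map + binForm D.r (X 0) (X 1) D.map = 0 := by
  have := D.sum_aeval_col₁_mul X D.map
  simp only [aeval_X_left_apply] at this
  rw [← this, sum_col₁_mul_map]

/-- `Ψ ∘ Φ = id`. -/
theorem bind₁_map_inverse (j : Fin 3) : bind₁ D.map (D.inverse j) =
    D.factor ^ (m + 1) * binForm D.q (X 0) (X 1) D.map * X j := by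
  have hb := D.linForm_b_map
  have ha := D.linForm_a_map
  change aeval D.map (D.inverse j) = _
  fin_cases j
  · change aeval D.map (D.inverse 0) = _
    rw [aeval_inverse_zero, D.qForm_eq hb ha, hb, Fin.zero_eta]
    ring
  · change aeval D.map (D.inverse 1) = _
    rw [aeval_inverse_one, D.qForm_eq hb ha, ha, Fin.mk_one]
    ring
  · change aeval D.map (D.inverse 2) = _ * X 2
    rw [aeval_inverse_two, D.rForm_eq hb ha]
    linear_combination -D.factor ^ (m + 1) * D.X_two_mul_binForm_map

/-- `Φ ∘ Ψ = id`: at `x = Ψ(y)` both columns are orthogonal to `y`. -/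
theorem bind₁_inverse_map (j : Fin 3) : bind₁ D.inverse (D.map j) =
    -D.qForm X * (∑ i, C (crossProduct D.a D.b i) * aeval D.inverse (D.col₁ i)) * X j := by
  have h0 : D.inverse 0 = D.qForm X * linForm D.b X := mul_comm _ _
  have h1 : D.inverse 1 = D.qForm X * -linForm D.a X := mul_comm _ _
  have h2 : D.inverse 2 = -D.rForm X := rfl
  have hcol : ∑ i, aeval D.inverse (D.col₁ i) * X i = 0 := by
    rw [sum_aeval_col₁_mul, h0, h1, h2, binForm_mul D.hq, binForm_mul D.hr, rForm, qForm]
    ring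
  change aeval D.inverse (D.map j) = _
  rw [aeval_map]
  simp only [Fin.sum_univ_three] at hcol
  have hcross : ∀ i, aeval D.inverse (D.col₀ i) = D.qForm X *
      (C (D.a i) * linForm D.b X - C (D.b i) * linForm D.a X) := fun i => by
    rw [aeval_col₀, h0, h1]
    simp only [algebraMap_eq]
    ring
  obtain ⟨p, hp⟩ : ∃ p : Fin 3 → PlaneRing k, ∀ i, aeval D.inverse (D.col₁ i) = p i :=
    ⟨_, fun _ => rfl⟩
  simp only [hp] at hcol
  simp only [hcross, hp]
  generalize D.qForm (X : Fin 3 → PlaneRing k) = Q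
  fin_cases j <;> simp [cross_apply, linForm, Fin.sum_univ_three]
  · linear_combination Q * (C (D.a 1) * C (D.b 2) - C (D.a 2) * C (D.b 1)) * hcol
  · linear_combination Q * (C (D.a 2) * C (D.b 0) - C (D.a 0) * C (D.b 2)) * hcol
  · linear_combination Q * (C (D.a 0) * C (D.b 1) - C (D.a 1) * C (D.b 0)) * hcol

section Dominant

variable {D}

theorem map_ne_zero_of_dominant
    (hdom : ∀ (d : ℕ) (F : PlaneRing k), F.IsHomogeneous d → aeval D.map F = 0 → F = 0) :
    D.map ≠ 0 := fun h0 =>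
  X_ne_zero (0 : Fin 3) (hdom 1 (X 0) (isHomogeneous_X _ _) (by rw [aeval_X, h0, Pi.zero_apply]))

theorem factor_ne_zero_of_dominant
    (hdom : ∀ (d : ℕ) (F : PlaneRing k), F.IsHomogeneous d → aeval D.map F = 0 → F = 0) :
    D.factor ≠ 0 := by
  intro h0
  have hlin : ∀ c : Fin 3 → k, linForm c D.map = 0 → c = 0 := fun c hc => by
    have h1 := hdom 1 (linForm c X) (linForm_isHomogeneous c) (by
      rw [map_linForm]
      simpa using hc)
    funext i
    have h2 := congrArg (eval (Pi.single i 1)) h1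
    simpa [linForm, Pi.single_apply] using h2
  have hb := hlin D.b (by rw [linForm_b_map, h0, zero_mul])
  have ha := hlin D.a (by rw [← neg_eq_zero, linForm_a_map, h0, zero_mul])
  refine map_ne_zero_of_dominant hdom ?_
  have : D.col₀ = 0 := by
    funext j
    simp [col₀, ha, hb]
  rw [map, this, LinearMap.map_zero, LinearMap.zero_apply]

/-- If `∑ⱼ qⱼ(x₀, x₁) Φⱼ` vanished, then `∑ⱼ qⱼ(b · y, - a · y) yⱼ` and its analogue for `r` would
vanish on the image of `Φ`, hence identically, so that the second column of the matrix would be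
orthogonal to every vector orthogonal to the first one. -/
theorem binForm_map_ne_zero_of_dominant
    (hdom : ∀ (d : ℕ) (F : PlaneRing k), F.IsHomogeneous d → aeval D.map F = 0 → F = 0) :
    binForm D.q (X 0) (X 1) D.map ≠ 0 := by
  intro h0
  have hb := D.linForm_b_map
  have ha := D.linForm_a_map
  have h1 : binForm D.r (X 0) (X 1) D.map = 0 := by
    have := D.X_two_mul_binForm_map
    rwa [h0, mul_zero, zero_add] at this
  have hQ : D.qForm (X : Fin 3 → PlaneRing k) = 0 :=
    hdom _ _ D.qForm_isHomogeneous (by rw [aeval_qForm, D.qForm_eq hb ha, h0, mul_zero])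
  have hR : D.rForm (X : Fin 3 → PlaneRing k) = 0 :=
    hdom _ _ D.rForm_isHomogeneous (by rw [aeval_rForm, D.rForm_eq hb ha, h1, mul_zero])
  -- `y` is the cross product of the first column with a generic vector `z`.
  let x : Fin 3 → BiRing k := fun i => X (Sum.inl i)
  let z : Fin 3 → BiRing k := fun i => X (Sum.inr i)
  let y : Fin 3 → BiRing k := crossProduct (fun i => aeval x (D.col₀ i)) z
  have hc : linForm (crossProduct D.b D.a) z ≠ 0 := by
    intro hz
    refine factor_ne_zero_of_dominant hdom ?_
    have h2 := congrArg (aeval (Sum.elim (X : Fin 3 → PlaneRing k) D.col₁)) hz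
    rw [map_zero, map_linForm] at h2
    simpa [z, factor] using h2
  have hyb : linForm D.b y = linForm (crossProduct D.b D.a) z * x 0 := D.linForm_b_cross x z
  have hya : -linForm D.a y = linForm (crossProduct D.b D.a) z * x 1 := D.linForm_a_cross x z
  have hQy : binForm D.q (x 0) (x 1) y = 0 := by
    have h2 := D.qForm_eq hyb hya
    rw [← aeval_qForm, hQ, map_zero, eq_comm] at h2
    exact (mul_eq_zero.1 h2).resolve_left (pow_ne_zero _ hc)
  have hRy : binForm D.r (x 0) (x 1) y = 0 := by
    have h2 := D.rForm_eq hyb hya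
    rw [← aeval_rForm, hR, map_zero, eq_comm] at h2
    exact (mul_eq_zero.1 h2).resolve_left (pow_ne_zero _ hc)
  have hy := D.sum_aeval_col₁_mul x y
  rw [hQy, hRy, mul_zero, add_zero] at hy
  refine map_ne_zero_of_dominant hdom (funext fun j => ?_)
  have h3 := congrArg (aeval (Sum.elim (X : Fin 3 → PlaneRing k) (Pi.single j 1))) hy
  have h4 : ∀ f : PlaneRing k,
      aeval (Sum.elim (X : Fin 3 → PlaneRing k) (Pi.single j 1)) (aeval x f) = f := fun f => by
    have : (aeval x : PlaneRing k →ₐ[k] BiRing k) = rename Sum.inl :=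
      algHom_ext fun i => by simp [x]
    rw [this, aeval_rename_inl, aeval_X_left_apply]
  rw [map_zero] at h3
  simp only [y, Fin.sum_univ_three, cross_apply, Matrix.cons_val_zero, Matrix.cons_val_one,
    Matrix.cons_val, map_add, map_sub, map_mul, h4, z, aeval_X, Sum.elim_inr] at h3
  fin_cases j <;> simp [map, cross_apply] at h3 ⊢ <;> linear_combination -h3

theorem isBirationalMap_of_dominant
    (hdom : ∀ (d : ℕ) (F : PlaneRing k), F.IsHomogeneous d → aeval D.map F = 0 → F = 0) :
    ∃ h g : PlaneRing k, h ≠ 0 ∧ g ≠ 0 ∧ (∀ j, bind₁ D.map (D.inverse j) = h * X j) ∧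
      ∀ j, bind₁ D.inverse (D.map j) = g * X j := by
  have hh : D.factor ^ (m + 1) * binForm D.q (X 0) (X 1) D.map ≠ 0 :=
    mul_ne_zero (pow_ne_zero _ (factor_ne_zero_of_dominant hdom))
      (binForm_map_ne_zero_of_dominant hdom)
  refine ⟨_, _, hh, fun hg => ?_, D.bind₁_map_inverse, D.bind₁_inverse_map⟩
  -- Otherwise `Φ ∘ Ψ ∘ Φ`, which is a nonzero multiple of `Φ`, would vanish.
  obtain ⟨l, hl⟩ := Function.ne_iff.1 (map_ne_zero_of_dominant hdom)
  have h1 := congrArg (aeval D.map) (D.bind₁_inverse_map l)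
  rw [hg, zero_mul, map_zero, aeval_bind₁] at h1
  have h2 : (fun i => aeval D.map (D.inverse i)) = fun i =>
      D.factor ^ (m + 1) * binForm D.q (X 0) (X 1) D.map * X i :=
    funext D.bind₁_map_inverse
  rw [h2, aeval_mul_of_isHomogeneous (D.map_isHomogeneous l), aeval_X_left_apply] at h1
  exact mul_ne_zero (pow_ne_zero _ hh) hl h1

end Dominant

/-! ### The torsion component over a general point of the target -/

section Torsion

variable {S : Type u} [CommRing S] [Algebra k S]

theorem linForm_eq_zero_of_vanishesAt_naive {x y : Fin 3 → S}
    (h : VanishesAt (naiveGraphIdeal D.map) x y) :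
    x 0 * linForm D.a y + x 1 * linForm D.b y = 0 := by
  rw [← sum_aeval_col₀_mul]
  simpa using h _ (syzygy_mem_naiveGraphIdeal D.sum_col₀_mul_map)

theorem binForm_eq_zero_of_vanishesAt_naive {x y : Fin 3 → S}
    (h : VanishesAt (naiveGraphIdeal D.map) x y) :
    x 2 * binForm D.q (x 0) (x 1) y + binForm D.r (x 0) (x 1) y = 0 := by
  rw [← sum_aeval_col₁_mul]
  simpa using h _ (syzygy_mem_naiveGraphIdeal D.sum_col₁_mul_map)

/-- By the Hilbert-Burch theorem the naive graph is defined by the equations given by the two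
columns of the matrix. -/
theorem vanishesAt_naive (h2 : 2 ≤ (baseIdeal D.map).height) {x y : Fin 3 → S}
    (h₀ : x 0 * linForm D.a y + x 1 * linForm D.b y = 0)
    (h₁ : x 2 * binForm D.q (x 0) (x 1) y + binForm D.r (x 0) (x 1) y = 0) :
    VanishesAt (naiveGraphIdeal D.map) x y := by
  refine naiveGraphIdeal_le_ker (aeval (Sum.elim x y) : BiRing k →ₐ[k] S).toRingHom fun s hs => ?_
  obtain ⟨α, β, hαβ⟩ := syzygy_eq_combination h2 hs
  change ∑ j, aeval (Sum.elim x y) (rename Sum.inl (s j)) * aeval (Sum.elim x y) (X (Sum.inr j)) = 0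
  simp only [aeval_rename_inl, aeval_X, Sum.elim_inr]
  rw [← sum_aeval_col₀_mul] at h₀
  rw [← sum_aeval_col₁_mul] at h₁
  calc ∑ j, aeval x (s j) * y j = aeval x α * ∑ j, aeval x (D.col₀ j) * y j +
        aeval x β * ∑ j, aeval x (D.col₁ j) * y j := by
        rw [Finset.mul_sum, Finset.mul_sum, ← Finset.sum_add_distrib]
        refine Finset.sum_congr rfl fun j _ => ?_
        rw [hαβ, map_add, map_mul, map_mul]
        ring
    _ = 0 := by rw [h₀, h₁, mul_zero, mul_zero, add_zero]

/-- On the naive graph, `x₀ ^ m` kills the minors of `(x, Ψ(y))`. -/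
theorem pow_mul_minor_eq_zero {x y : Fin 3 → S} (h : VanishesAt (naiveGraphIdeal D.map) x y)
    (i : Fin 3) :
    x 0 ^ m * (x i * aeval y (D.inverse 0) - x 0 * aeval y (D.inverse i)) = 0 := by
  have h₀ := D.linForm_eq_zero_of_vanishesAt_naive h
  have h₁ := D.binForm_eq_zero_of_vanishesAt_naive h
  have hx₁ : x 0 * -linForm D.a y = linForm D.b y * x 1 := by linear_combination -h₀
  have hQ : x 0 ^ m * D.qForm y = linForm D.b y ^ m * binForm D.q (x 0) (x 1) y := by
    rw [qForm, ← binForm_mul D.hq, ← binForm_mul D.hq, hx₁, mul_comm (x 0)]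
  have hR : x 0 ^ (m + 1) * D.rForm y =
      linForm D.b y ^ (m + 1) * binForm D.r (x 0) (x 1) y := by
    rw [rForm, ← binForm_mul D.hr, ← binForm_mul D.hr, hx₁, mul_comm (x 0)]
  fin_cases i
  · simp
  · change x 0 ^ m * (x 1 * aeval y (D.inverse 0) - x 0 * aeval y (D.inverse 1)) = 0
    rw [aeval_inverse_zero, aeval_inverse_one]
    linear_combination x 0 ^ m * D.qForm y * h₀
  · change x 0 ^ m * (x 2 * aeval y (D.inverse 0) - x 0 * aeval y (D.inverse 2)) = 0
    rw [aeval_inverse_zero, aeval_inverse_two]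
    linear_combination x 2 * linForm D.b y * hQ + hR + linForm D.b y ^ (m + 1) * h₁

/-- Where `Ψ₀(y)` is invertible, the graph is defined by the minors of `(x, Ψ(y))`, and these are
killed by `x₀ ^ m` on the naive graph. -/
theorem exists_mem_torsionIdeal [Infinite k] {g : PlaneRing k} (hg : g ≠ 0)
    (hgψ : ∀ j, bind₁ D.inverse (D.map j) = g * X j) :
    ∃ e : ℕ, X (Sum.inl 0) ^ m * rename Sum.inr (D.inverse 0) ^ e ∈ torsionIdeal D.map := by
  let K : Ideal (BiRing k) := Ideal.span (Set.range fun i : Fin 3 =>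
    X (Sum.inl i) * rename Sum.inr (D.inverse 0) - X (Sum.inl 0) * rename Sum.inr (D.inverse i))
  have hK : ∀ F ∈ K, X (Sum.inl 0) ^ m * F ∈ naiveGraphIdeal D.map := by
    intro F hF
    induction hF using Submodule.span_induction with
    | mem F hF =>
      obtain ⟨i, rfl⟩ := hF
      rw [← Ideal.Quotient.eq_zero_iff_mem, ← aeval_mk_X]
      simpa using D.pow_mul_minor_eq_zero (vanishesAt_mk_X _) i
    | zero => rw [mul_zero]; exact zero_mem _
    | add F G _ _ hF hG => rw [mul_add]; exact add_mem hF hG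
    | smul A F _ hF => rw [smul_eq_mul, mul_left_comm]; exact Ideal.mul_mem_left _ _ hF
  obtain ⟨e, he⟩ := exists_pow_mul_mem_of_fg (IsNoetherian.noetherian (graphIdeal D.map))
    (K := K) (rename Sum.inr (D.inverse 0)) fun F hF =>
      exists_pow_mul_mem_of_forall_isUnit fun S _ _ x y hxy hu => by
        rw [aeval_rename_inr] at hu
        obtain ⟨w, hw⟩ := hu.exists_right_inv
        have hx : x = fun i => x 0 * w * aeval y (D.inverse i) := by
          funext i
          have := vanishesAt_span.1 hxy _ (Set.mem_range_self i)
          simp only [map_sub, map_mul, aeval_X, aeval_rename_inr, Sum.elim_inl] at this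
          linear_combination w * this - x i * hw
        rw [hx]
        exact aeval_inverse_eq_zero_of_mem_graphIdeal D.map_isHomogeneous hg hgψ hF y _
  refine ⟨e, mem_torsionIdeal_of_forall_mul_mem fun F hF => ?_⟩
  rw [mul_assoc]
  exact hK _ (he F hF)

/-- Over a general point `η` of the target, the torsion component is the subscheme `x₀ ^ m = 0` of
the line `(x₀ : x₁) = (b · η : - a · η)`. -/
theorem torsionIdeal_generalSectionLength_zero_two [Infinite k]
    (h2 : 2 ≤ (baseIdeal D.map).height) {h g : PlaneRing k} (hh : h ≠ 0)
    (hhφ : ∀ j, bind₁ D.map (D.inverse j) = h * X j) (hg : g ≠ 0)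
    (hgψ : ∀ j, bind₁ D.inverse (D.map j) = g * X j) :
    GeneralSectionLength (torsionIdeal D.map) 0 2 m := by
  have hψ0 : D.inverse 0 ≠ 0 := fun h0 =>
    mul_ne_zero hh (X_ne_zero 0) (by rw [← hhφ 0, h0, map_zero])
  refine generalSectionLength_zero_two hψ0 fun b hb => ?_
  set η := crossProduct (b 0) (b 1) with hη
  obtain ⟨v, hv⟩ := exists_dot_eq_one
    (ne_zero_of_eval_ne_zero (D.inverse_isHomogeneous 0) (by omega) hb)
  obtain ⟨e, he⟩ := D.exists_mem_torsionIdeal hg hgψ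
  have hLη : linForm D.b η ≠ 0 := fun h0 => hb (by
    rw [← aeval_eq_eval, aeval_inverse_zero, h0, zero_mul])
  have hlin : ∀ {A : Type u} [CommRing A] [Algebra k A] {y : Fin 3 → A} {s : A},
      (∀ i, y i = s * algebraMap k A (η i)) →
      ∀ c : Fin 3 → k, linForm c y = s * algebraMap k A (linForm c η) := by
    intro A _ _ y s hy c
    simp only [linForm, map_sum, map_mul, Finset.mul_sum, hy, Algebra.algebraMap_self,
      RingHom.id_apply]
    exact Finset.sum_congr rfl fun i _ => by ring
  have hinv : ∀ {A : Type u} [CommRing A] [Algebra k A] {y : Fin 3 → A} {s : A},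
      (∀ i, y i = s * algebraMap k A (η i)) → ∀ j,
      aeval y (D.inverse j) = s ^ (m + 2) * algebraMap k A (eval η (D.inverse j)) := by
    intro A _ _ y s hy j
    rw [← aeval_algebraMap_comp, ← aeval_mul_of_isHomogeneous (D.inverse_isHomogeneous j)]
    congr 2
    exact funext hy
  have hpt : ∀ {A : Type u} [CommRing A] [Algebra k A] {x y : Fin 3 → A},
      VanishesAt (torsionIdeal D.map ⊔ Ideal.span (Set.range fun s => yForm (b s))) x y →
      (∀ i, y i = (∑ j, algebraMap k A (v j) * y j) * algebraMap k A (η i)) ∧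
      x 0 ^ m * aeval y (D.inverse 0) ^ e = 0 ∧
      x 0 * linForm D.a y + x 1 * linForm D.b y = 0 := by
    intro A _ _ x y hxy
    rw [vanishesAt_sup_range] at hxy
    refine ⟨eq_mul_of_parallel hv (parallel_cross (by simpa using hxy.2 0)
      (by simpa using hxy.2 1)), by simpa using hxy.1 _ he, ?_⟩
    exact D.linForm_eq_zero_of_vanishesAt_naive
      fun F hF => hxy.1 F (naiveGraphIdeal_le_torsionIdeal _ hF)
  have hP : (Polynomial.X ^ m : Polynomial k).natDegree = m := Polynomial.natDegree_X_pow m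
  let κ : k := -(linForm D.a η / linForm D.b η)
  suffices key : HasLength (torsionIdeal D.map ⊔ Ideal.span (Set.range fun s => yForm (b s)))
      (Polynomial.X ^ m : Polynomial k).natDegree by rwa [hP] at key
  have hηrfl : ∀ {A : Type u} [CommRing A] [Algebra k A] (i : Fin 3),
      algebraMap k A (η i) = 1 * algebraMap k A (η i) := fun i => (one_mul _).symm
  have hu : ∀ {A : Type u} [CommRing A] [Algebra k A] (x : Fin 3 → A),
      ∑ i, algebraMap k A ((Pi.single 2 1 : Fin 3 → k) i) * x i = x 2 := fun x => by
    simp [Pi.single_apply, apply_ite]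
  refine hasLength_natDegree (u := Pi.single 2 1) (v := v) (pow_ne_zero m Polynomial.X_ne_zero)
    ![Polynomial.X, Polynomial.C κ * Polynomial.X, 1] (fun i => Polynomial.C (η i))
    (X (Sum.inl 0)) (fun A _ _ x y hxy hx2 => ?_) (fun A _ _ x y hxy hvy => ?_) ?_ ?_ ?_ ?_
    fun A _ _ x y hxy hx2 hvy => ?_
  · obtain ⟨hy, hx0, hx1⟩ := hpt hxy
    rw [hu] at hx2
    by_cases hs : ∑ j, algebraMap k A (v j) * y j = 0
    · exact Or.inr (funext fun i => by rw [hy, hs, zero_mul, Pi.zero_apply])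
    left
    rw [hinv hy] at hx0
    have h0 : x 0 = 0 := eq_zero_of_pow_eq_zero ((mul_eq_zero.1 hx0).resolve_right
      (pow_ne_zero _ (mul_ne_zero (pow_ne_zero _ hs) ((map_ne_zero (algebraMap k A)).2 hb))))
    rw [h0, zero_mul, zero_add, hlin hy] at hx1
    have h1 : x 1 = 0 := (mul_eq_zero.1 hx1).resolve_right
      (mul_ne_zero hs ((map_ne_zero (algebraMap k A)).2 hLη))
    funext i
    fin_cases i
    · exact h0
    · exact h1
    · exact hx2
  · exact Or.inr (funext fun i => by rw [(hpt hxy).1, hvy, zero_mul, Pi.zero_apply])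
  · -- The chosen point lies on the naive graph, and `x₂ Ψ₀(y) - x₀ Ψ₂(y)` is invertible there.
    have hroot : (AdjoinRoot.mk (Polynomial.X ^ m : Polynomial k) Polynomial.X) ^ m = 0 := by
      rw [← map_pow, AdjoinRoot.mk_self]
    have hC : ∀ c : k, AdjoinRoot.mk (Polynomial.X ^ m : Polynomial k) (Polynomial.C c) =
        algebraMap k _ c := fun c => rfl
    generalize hρ : AdjoinRoot.mk (Polynomial.X ^ m : Polynomial k) Polynomial.X = ρ at hroot
    have hxs : (fun i => AdjoinRoot.mk (Polynomial.X ^ m : Polynomial k)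
        ((![Polynomial.X, Polynomial.C κ * Polynomial.X, 1] : Fin 3 → Polynomial k) i)) =
        ![ρ, algebraMap k _ κ * ρ, 1] := by
      funext i
      fin_cases i <;> simp [hρ]
    have hκ : linForm D.a η + κ * linForm D.b η = 0 := by
      simp only [κ]
      field_simp
      ring
    have hκ' := congrArg (algebraMap k (AdjoinRoot (Polynomial.X ^ m : Polynomial k))) hκ
    rw [map_add, map_mul, map_zero] at hκ'
    rw [hxs, vanishesAt_sup_range]
    simp only [hC]
    refine ⟨vanishesAt_torsionIdeal (D.vanishesAt_naive h2 ?_ ?_)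
      (inverse_minor_mem_graphIdeal D.inverse_isHomogeneous hhφ 2 0) ?_, fun s => ?_⟩
    · rw [hlin hηrfl, hlin hηrfl]
      simp only [Matrix.cons_val_zero, Matrix.cons_val_one]
      linear_combination ρ * hκ'
    · have h3 : ∀ {q : Fin 3 → MvPolynomial (Fin 2) k} {d : ℕ},
          (∀ j, (q j).IsHomogeneous d) → m ≤ d → binForm q ρ (algebraMap k _ κ * ρ)
            (fun i => algebraMap k (AdjoinRoot (Polynomial.X ^ m : Polynomial k)) (η i)) = 0 := by
        intro q d hq hd
        have := binForm_mul hq ρ 1 (algebraMap k _ κ)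
          (fun i => algebraMap k (AdjoinRoot (Polynomial.X ^ m : Polynomial k)) (η i))
        rw [mul_one, mul_comm ρ] at this
        rw [this, pow_eq_zero_of_le hd hroot, zero_mul]
      simp only [Matrix.cons_val_zero, Matrix.cons_val_one]
      rw [h3 D.hq le_rfl, h3 D.hr (Nat.le_succ m), mul_zero, add_zero]
    · simp only [map_sub, map_mul, aeval_X, aeval_rename_inr, Sum.elim_inl, hinv hηrfl, one_pow,
        one_mul, Matrix.cons_val_zero, Matrix.cons_val]
      rw [sub_eq_add_neg]
      refine IsNilpotent.isUnit_add_left_of_commute ?_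
        ((IsUnit.mk0 _ hb).map (algebraMap k _)) (Commute.all _ _)
      exact ⟨m, by rw [← neg_mul, mul_pow, neg_pow, hroot, mul_zero, zero_mul]⟩
    · rw [aeval_yForm, hη, Fin.sum_univ_three]
      fin_cases s <;> simp [cross_apply] <;> ring
  · rw [hu]
    exact map_one _
  · have hC : ∀ c : k, AdjoinRoot.mk (Polynomial.X ^ m : Polynomial k) (Polynomial.C c) =
        algebraMap k _ c := fun c => rfl
    simp only [hC, ← map_mul, ← map_sum, hv, map_one]
  · rw [aeval_X]
    rfl
  · obtain ⟨hy, hx0, hx1⟩ := hpt hxy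
    rw [hu] at hx2
    rw [hvy] at hy
    rw [hinv hy, one_pow, one_mul] at hx0
    rw [hlin hy, hlin hy, one_mul, one_mul] at hx1
    have hx0' : x 0 ^ m = 0 :=
      (((IsUnit.mk0 _ hb).map (algebraMap k A)).pow e).mul_left_eq_zero.1 hx0
    have hκ : algebraMap k A κ * algebraMap k A (linForm D.b η) =
        -algebraMap k A (linForm D.a η) := by
      rw [← map_mul, ← map_neg]
      congr 1
      simp only [κ]
      field_simp
    have hx1' : x 1 = algebraMap k A κ * x 0 :=
      ((IsUnit.mk0 _ hLη).map (algebraMap k A)).mul_right_cancel (by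
        linear_combination hx1 - x 0 * hκ)
    rw [aeval_X, Sum.elim_inl]
    refine ⟨by simpa using hx0', fun i => ?_, fun i => by simpa using (hy i).symm⟩
    fin_cases i
    · simp
    · simpa using hx1'.symm
    · simpa using hx2.symm

end Torsion

end JonquieresData

/-! ### Forms with a point of given multiplicity -/

theorem le_of_mem_support_of_mem_pointIdeal_pow {e : ℕ} {p : PlaneRing k}
    (hp : p ∈ pointIdeal k ^ e) {d : Fin 3 →₀ ℕ} (hd : d ∈ p.support) : e ≤ d 0 + d 1 := by
  have key : pointIdeal k ^ e ≤
      Ideal.span ((fun s => monomial s (1 : k)) '' {d : Fin 3 →₀ ℕ | e ≤ d 0 + d 1}) := by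
    clear hp hd
    induction e with
    | zero =>
      refine le_of_le_of_eq le_top (Eq.symm ?_)
      rw [Ideal.eq_top_iff_one]
      exact Ideal.subset_span ⟨0, Nat.zero_le _, rfl⟩
    | succ e ih =>
      rw [pow_succ]
      refine (Ideal.mul_mono_left ih).trans ?_
      rw [pointIdeal, Ideal.span_mul_span', Ideal.span_le]
      rintro _ ⟨_, ⟨d, hd, rfl⟩, x, hx, rfl⟩
      refine Ideal.subset_span ?_
      rcases hx with rfl | rfl
      · refine ⟨d + Finsupp.single 0 1, ?_, by simp [X, monomial_mul]⟩
        simp at hd ⊢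
        omega
      · refine ⟨d + Finsupp.single 1 1, ?_, by simp [X, monomial_mul]⟩
        simp at hd ⊢
        omega
  obtain ⟨s, hs, hle⟩ := mem_ideal_span_monomial_image.1 (key hp) d hd
  exact le_trans hs (Nat.add_le_add (hle 0) (hle 1))

theorem degree_eq_of_mem_support {e : ℕ} {p : PlaneRing k} (hp : p.IsHomogeneous e)
    {d : Fin 3 →₀ ℕ} (hd : d ∈ p.support) : d 0 + d 1 + d 2 = e := by
  have h := hp (mem_support_iff.1 hd)
  rw [Finsupp.weight_apply, Finsupp.sum_fintype _ _ (by simp), Fin.sum_univ_three] at h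
  simpa using h

/-- A form of degree `m + 1` with multiplicity at least `m` at `(0 : 0 : 1)` is of degree at most
one in `x₂`. -/
theorem exists_eq_X_two_mul_add {m : ℕ} {p : PlaneRing k} (hp : p.IsHomogeneous (m + 1))
    (hmem : p ∈ pointIdeal k ^ m) : ∃ q r : MvPolynomial (Fin 2) k, q.IsHomogeneous m ∧
      r.IsHomogeneous (m + 1) ∧ p = X 2 * aeval ![X 0, X 1] q + aeval ![X 0, X 1] r := by
  let t : (Fin 3 →₀ ℕ) → Fin 2 →₀ ℕ := fun d => Finsupp.equivFunOnFinite.symm ![d 0, d 1]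
  let F : ℕ → MvPolynomial (Fin 2) k := fun i =>
    ∑ d ∈ p.support with d 2 = i, monomial (t d) (p.coeff d)
  have hF : ∀ i e, i + e = m + 1 → (F i).IsHomogeneous e := by
    intro i e hie
    refine IsHomogeneous.sum _ _ _ fun d hd => isHomogeneous_monomial _ ?_
    rw [Finset.mem_filter] at hd
    have := degree_eq_of_mem_support hp hd.1
    simp [t, Finsupp.degree_eq_sum]
    omega
  have haF : ∀ i, X 2 ^ i * aeval ![X 0, X 1] (F i) =
      ∑ d ∈ p.support with d 2 = i, monomial d (p.coeff d) := by
    intro i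
    rw [map_sum, Finset.mul_sum]
    refine Finset.sum_congr rfl fun d hd => ?_
    rw [← (Finset.mem_filter.1 hd).2, aeval_monomial, monomial_eq,
      Finsupp.prod_fintype _ _ (by simp), Finsupp.prod_fintype _ _ (by simp)]
    simp [t, Fin.prod_univ_three, algebraMap_eq]
    ring
  refine ⟨F 1, F 0, hF 1 m (by omega), hF 0 (m + 1) (by omega), ?_⟩
  have h0 := haF 0
  have h1 := haF 1
  rw [pow_zero, one_mul] at h0
  rw [pow_one] at h1
  rw [h0, h1]
  conv_lhs => rw [p.as_sum]
  rw [← Finset.sum_filter_add_sum_filter_not p.support (fun d => d 2 = 1)]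
  congr 1
  refine Finset.sum_congr (Finset.filter_congr fun d hd => ?_) fun _ _ => rfl
  have := degree_eq_of_mem_support hp hd
  have := le_of_mem_support_of_mem_pointIdeal_pow hmem hd
  omega

theorem exists_eq_C_mul_X_zero_add {p : PlaneRing k} (hp : p.IsHomogeneous 1)
    (hmem : p ∈ pointIdeal k) : ∃ a b : k, p = C a * X 0 + C b * X 1 := by
  have h : ∀ q ∈ pointIdeal k, eval ![0, 0, 1] q = 0 := fun q hq => by
    have : pointIdeal k ≤ RingHom.ker (eval ![0, 0, 1]) := by
      rw [pointIdeal, Ideal.span_le]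
      rintro _ (rfl | rfl) <;> simp
    exact this hq
  have h1 : p ∈ homogeneousSubmodule (Fin 3) k 1 := hp
  rw [homogeneousSubmodule_one_eq_span_X] at h1
  obtain ⟨c, rfl⟩ := (Submodule.mem_span_range_iff_exists_fun k).1 h1
  have h2 := h _ hmem
  refine ⟨c 0, c 1, ?_⟩
  simp [Fin.sum_univ_three, smul_eval] at h2
  simp [Fin.sum_univ_three, h2, smul_eq_C_mul]

theorem minors_eq_crossProduct (M : Matrix (Fin 3) (Fin 2) (PlaneRing k)) :
    minors M = crossProduct (fun j => M j 0) (fun j => M j 1) := by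
  funext j
  fin_cases j <;> simp [minors, Matrix.det_fin_two, cross_apply, Fin.succAbove] <;> ring

theorem IsDominantMap.eq_zero_of_aeval_eq_zero {φ : Fin 3 → PlaneRing k} (h : IsDominantMap φ)
    {d : ℕ} {F : PlaneRing k} (hF : F.IsHomogeneous d) (h0 : aeval φ F = 0) : F = 0 := by
  refine h d F hF fun x _ => ?_
  have hc : (aeval x : PlaneRing k →ₐ[k] k).comp (aeval φ) = aeval (value φ x) :=
    algHom_ext fun i => by simp [value, aeval_eq_eval]
  rw [← aeval_eq_eval, ← hc, AlgHom.comp_apply, h0, map_zero]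

end PlaneMap

theorem lemma2p3 {k : Type*} [Field k] [Infinite k] (n : ℕ) (hn : 2 ≤ n)
    (M : Matrix (Fin 3) (Fin 2) (PlaneMap.PlaneRing k))
    (hdeg₀ : ∀ j, (M j 0).IsHomogeneous 1)
    (hmem₀ : ∀ j, M j 0 ∈ PlaneMap.pointIdeal k)
    (hdeg₁ : ∀ j, (M j 1).IsHomogeneous (n - 1))
    (hmem₁ : ∀ j, M j 1 ∈ PlaneMap.pointIdeal k ^ (n - 2))
    (hnot : ∃ j, M j 1 ∉ PlaneMap.pointIdeal k ^ (n - 1))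
    (hheight : (PlaneMap.baseIdeal (PlaneMap.minors M)).height = 2)
    (hdom : PlaneMap.IsDominantMap (PlaneMap.minors M)) :
    PlaneMap.HasMultidegree (PlaneMap.torsionIdeal (PlaneMap.minors M)) ![n - 2, 0, 0] ∧
    PlaneMap.HasMultidegree (PlaneMap.graphIdeal (PlaneMap.minors M)) ![1, n, 1] ∧
    PlaneMap.IsBirationalMap (PlaneMap.minors M) := by
  obtain ⟨m, rfl⟩ := Nat.exists_eq_add_of_le' hn
  choose a b hab using fun j => PlaneMap.exists_eq_C_mul_X_zero_add (hdeg₀ j) (hmem₀ j)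
  choose q r hq hr hqr using fun j => PlaneMap.exists_eq_X_two_mul_add (hdeg₁ j) (hmem₁ j)
  let D : PlaneMap.JonquieresData k m := ⟨a, b, q, r, hq, hr⟩
  have hM : PlaneMap.minors M = D.map := by
    rw [PlaneMap.minors_eq_crossProduct, funext hab, funext hqr]
    rfl
  rw [hM] at hheight hdom ⊢
  have h2 := hheight.ge
  obtain ⟨h, g, hh, hg, hhφ, hgψ⟩ :=
    D.isBirationalMap_of_dominant fun d F => hdom.eq_zero_of_aeval_eq_zero
  refine ⟨fun i => ?_, ?_, m + 2, D.inverse, D.inverse_isHomogeneous, ⟨h, hh, hhφ⟩, g, hg, hgψ⟩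
  · fin_cases i
    · exact D.torsionIdeal_generalSectionLength_zero_two h2 hh hhφ hg hgψ
    · exact PlaneMap.torsionIdeal_generalSectionLength_one_one D.map_isHomogeneous h2
    · exact PlaneMap.torsionIdeal_generalSectionLength_two_zero D.map_isHomogeneous
        (PlaneMap.ne_zero_of_two_le_height h2)
  · exact PlaneMap.graphIdeal_hasMultidegree (Nat.succ_ne_zero _) D.map_isHomogeneous h2
      D.inverse_isHomogeneous hh hhφ hg hgψ
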